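/- **Model.** Fix $\Delta>0$ and $W>0$. Let $n$ be even and let $m=\lfloor\sqrt n\rfloor$ (so $m=\sqrt n$ if $n$ is a perfect square). On the sphere $S^2$ of unit area, $n$ nodes are split uniformly at random into $n/2$ disjoint source-destination (S-D) pairs. Each node $i$ has a great circle $G_i$, whose pole is uniform on $S^2$, independently over the nodes. On each $G_i$ there are $m$ equidistant lattice points, numbered consecutively by $\mathbb Z/m$, whose placement on the circle is arbitrary (it may depend measurably on the whole configuration of circles, pairs and points $z_{ij}$). Each node performs on its lattice points a natural random walk in slotted time: it starts at a uniform lattice point, and its steps are i.i.d. uniform on $\{-1,0,1\}$; the walks are independent. For $i\ne j$, $z_{ij}=z_{ji}$ is one of the two points of $G_i\cap G_j$, chosen by independent fair coins; $\mathcal C_{ij}$ is the disk of radius $(2+\Delta)\sqrt{\pi/n}$ around $z_{ij}$. Nodes $i\neq j$ are *neighbors* in a time-slot if both are at lattice points of their circles closest to $z_{ij}$. With $d$ the distance on the sphere, a transmission from $i$ to $j$ is *successful* if $d(k,j)\ge(1+\Delta)\,d(i,j)$ for every other simultaneously transmitting node $k$; communication then occurs at rate $W$ per unit of time, and time-slots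 have unit length. For constants $0<a<b$, a configuration is *typical* if for all $i\ne j$ the number of great circles $G_k$ that meet $\mathcal C_{ij}$ lies in $[a\sqrt n,\,b\sqrt n]$. **Scheme $\Pi$** (with parameters $p,\alpha\in(0,1)$). If the configuration is not typical, the sources transmit directly to their destinations, one pair per time-slot, in round-robin order. If it is typical, each time-slot is divided into two sub-slots A and B of equal length, in each of which a packet of $W/2$ bits can be sent. In sub-slot A each source independently becomes active with probability $p$; an active source that has at least one neighbor, with probability $\alpha$, chooses one of its neighbors uniformly at random and transmits to it a new packet intended for its own destination (sources always have packets). If the transmission is successful, the packet is delivered if the receiver is the destination, and otherwise it joins the queue for this S-D pair at the receiver, which acts as a relay. In sub-slot B each node independently becomes active with probability $p$; an active node that has neighbors which are destinations chooses one of these uniformly at random and transmits to it the first packet (in FIFO order) in its queue for it, if there is one; if the transmission is successful, the packet is delivered and leaves the queue, and otherwise it stays there. **Throughput.** Let $B_n(i,t)$ be the number of bits of S-D pair $i$ delivered in the first $t$ time-slots. The scheme *has throughput* $T(n)$ if $$P\Big(\min_{1\le i\le n/2}\ \liminf_{t\to\infty}\tfrac1t B_n(i,t)\ \ge\ T(n)\Big)\to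 1\qquad (n\to\infty,\ n \text{ even}),$$ where $P$ is over the random network and the randomness of the policy. **Theorem.** Scheme $\Pi$ achieves throughput $T(n)=\Theta(1)$. Precisely: for every $\Delta>0$ there are $0<a_0<b_0$ such that for all $0<a\le a_0$, $b\ge b_0$, $W>0$ and $p,\alpha\in(0,1)$ there are constants $c>0$ and $C$ such that, for every placement of the lattice points, scheme $\Pi$ has throughput $T(n)=c$, and every $T(n)$ that is a throughput of scheme $\Pi$ satisfies $T(n)\le C$ for all sufficiently large $n$. -/

import Mathlib

open MeasureTheory ProbabilityTheory Filter Topology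

namespace MobileNet

noncomputable section

/-! ### The sphere of unit area

A point of the sphere of unit area (radius `1 / (2 √π)`) is represented by its direction, a unit
vector of `ℝ³`; distances are measured on the sphere of unit area. -/

/-- Euclidean three-space. -/
abbrev E3 : Type := EuclideanSpace ℝ (Fin 3)

/-- Directions, i.e. points of the sphere. -/
abbrev S2 : Type := Metric.sphere (0 : E3) 1

/-- The uniform probability distribution on the sphere. -/
def sphereUniform : Measure S2 :=
  ((volume : Measure E3).toSphere Set.univ)⁻¹ • (volume : Measure E3).toSphere

instance : IsProbabilityMeasure sphereUniform := by
  constructor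
  rw [sphereUniform, Measure.smul_apply, smul_eq_mul]
  refine ENNReal.inv_mul_cancel ?_ (measure_ne_top _ _)
  rw [Ne, Measure.measure_univ_eq_zero]
  exact Measure.toSphere_ne_zero _

/-- Geodesic distance on the sphere of unit area between the points in directions `u` and `v`. -/
def gdist (u v : E3) : ℝ := InnerProductGeometry.angle u v / (2 * √Real.pi)

/-- The cross product of `ℝ³`. -/
def cross (u v : E3) : E3 := WithLp.toLp 2 (crossProduct u.ofLp v.ofLp)

/-- The great circle with pole `x`. -/
def greatCircle (x : S2) : Set E3 := {u | ‖u‖ = 1 ∧ inner ℝ (x : E3) u = 0}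

/-- One of the two antipodal intersection points of the great circles with poles `x` and `y`
(when `x ≠ ± y`); the other one is its negative. -/
def crossing (x y : S2) : E3 := ‖cross x y‖⁻¹ • cross x y

/-- The disk on the sphere with center `z` and radius `R`. -/
def disk (z : E3) (R : ℝ) : Set E3 := {u | ‖u‖ = 1 ∧ gdist u z ≤ R}

/-! ### The random network with `n = 2 N` nodes and `N` source-destination pairs -/

/-- The nodes. -/
abbrev Node (N : ℕ) : Type := Fin (2 * N)

/-- The number of lattice points on each great circle: `√n`, rounded down if `n` is not a
perfect square. -/
def latticeSize (N : ℕ) : ℕ := Nat.sqrt (2 * N)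

/-- Assignments of the roles: `(i, false)` goes to the source and `(i, true)` to the destination
of pair `i`. -/
abbrev Pairing (N : ℕ) : Type := (Fin N × Bool) ≃ Node N

instance equivMeasurableSpace {α β : Type} : MeasurableSpace (α ≃ β) := ⊤

instance equivDiscrete {α β : Type} : DiscreteMeasurableSpace (α ≃ β) := ⟨fun _ => trivial⟩

/-- A configuration: the poles of the great circles of the nodes, the S-D pairing, and for each pair
of nodes `i < j` a bit (at `i j`) that selects one of the two intersection points of their great
circles. -/
abbrev Config (N : ℕ) : Type := (Node N → S2) × Pairing N × (Node N → Node N → Bool)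

/-- Poles i.i.d. uniform on the sphere, pairing uniformly random, selections by independent
fair coins. -/
def configMeasure (N : ℕ) : Measure (Config N) :=
  (Measure.pi fun _ => sphereUniform).prod
    ((uniformOn Set.univ).prod
      (Measure.pi fun _ => Measure.pi fun _ => uniformOn Set.univ))

namespace Config

variable {N : ℕ}

/-- The pole of the great circle of node `i`. -/
def pole (s : Config N) (i : Node N) : S2 := s.1 i

/-- The source of pair `i`. -/
def src (s : Config N) (i : Fin N) : Node N := s.2.1 (i, false)

/-- The destination of pair `i`. -/
def dst (s : Config N) (i : Fin N) : Node N := s.2.1 (i, true)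

/-- The selected intersection point of the great circles of two nodes with `i < j`. -/
def meetLt (s : Config N) (i j : Node N) : E3 :=
  if s.2.2 i j then crossing (s.pole i) (s.pole j) else -crossing (s.pole i) (s.pole j)

/-- The selected intersection point `z i j` of the great circles of nodes `i ≠ j`; symmetric. -/
def meet (s : Config N) (i j : Node N) : E3 :=
  if i < j then s.meetLt i j else s.meetLt j i

open Classical in
/-- The number of great circles passing through the disk around `z i j` of radius
`(2 + Δ) √(π / n)`. -/
def crossingCount (Δ : ℝ) (s : Config N) (i j : Node N) : ℕ :=
  (Finset.univ.filter fun k : Node N =>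
    (greatCircle (s.pole k) ∩
      disk (s.meet i j) ((2 + Δ) * √(Real.pi / ((2 * N : ℕ) : ℝ)))).Nonempty).card

/-- Typical configurations, with constants `a` and `b` in the `Θ(√n)` bound. -/
def Typical (Δ a b : ℝ) (s : Config N) : Prop :=
  ∀ i j : Node N, i ≠ j →
    a * √((2 * N : ℕ) : ℝ) ≤ (s.crossingCount Δ i j : ℝ) ∧
      (s.crossingCount Δ i j : ℝ) ≤ b * √((2 * N : ℕ) : ℝ)

end Config

/-- An arbitrary placement of the equidistant lattice points on the great circles: the position of
lattice point number `0` of each node, which may depend on the whole configuration. -/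
structure Placement (N : ℕ) where
  /-- Lattice point number `0` of each node. -/
  start : Config N → Node N → S2
  measurable_start : Measurable start
  start_mem : ∀ s i, (start s i : E3) ∈ greatCircle (s.pole i)

/-- Lattice point number `l` of node `i`. -/
def latticePoint {N : ℕ} (P : Placement N) (s : Config N) (i : Node N)
    (l : ZMod (latticeSize N)) : E3 :=
  Real.cos (2 * Real.pi * (l.val : ℝ) / (latticeSize N : ℝ)) • (P.start s i : E3) +
    Real.sin (2 * Real.pi * (l.val : ℝ) / (latticeSize N : ℝ)) •
      cross (s.pole i) (P.start s i)

/-! ### Randomness of the motion and of the policy -/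

/-- The randomness of one node in one time-slot: the step of its random walk (`0, 1, 2` stand for
`-1, 0, +1`), the coin for becoming active in sub-slot A, the coin for transmitting in sub-slot A
if active, a ranking of the nodes for the random choice in sub-slot A, the coin for becoming
active in sub-slot B, and a ranking of the nodes for the random choice in sub-slot B. -/
abbrev Noise (N : ℕ) : Type :=
  Fin 3 × Bool × Bool × Equiv.Perm (Node N) × Bool × Equiv.Perm (Node N)

namespace Noise

variable {N : ℕ}

/-- The displacement of the random walk. -/
def step (x : Noise N) : ZMod (latticeSize N) := ((x.1 : ℕ) : ZMod (latticeSize N)) - 1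

/-- Whether the node becomes active in sub-slot A (used for sources only). -/
def actA (x : Noise N) : Bool := x.2.1

/-- The coin of bias `α` in sub-slot A. -/
def sendA (x : Noise N) : Bool := x.2.2.1

/-- The ranking for the choice of a relay in sub-slot A. -/
def rankA (x : Noise N) : Equiv.Perm (Node N) := x.2.2.2.1

/-- Whether the node becomes active in sub-slot B. -/
def actB (x : Noise N) : Bool := x.2.2.2.2.1

/-- The ranking for the choice of a destination in sub-slot B. -/
def rankB (x : Noise N) : Equiv.Perm (Node N) := x.2.2.2.2.2

end Noise

/-- The law of the randomness of one node in one time-slot; all six components independent. -/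
def noiseMeasure (p α : unitInterval) (N : ℕ) : Measure (Noise N) :=
  (uniformOn Set.univ).prod
    ((bernoulliMeasure true false p).prod
      ((bernoulliMeasure true false α).prod
        ((uniformOn Set.univ).prod
          ((bernoulliMeasure true false p).prod (uniformOn Set.univ)))))

instance (p α : unitInterval) (N : ℕ) : IsProbabilityMeasure (noiseMeasure p α N) := by
  unfold noiseMeasure
  infer_instance

/-- The sample space: the configuration, the initial lattice positions of the nodes, and the
randomness of each node in each time-slot. -/
abbrev Sample (N : ℕ) : Type :=
  Config N × (Node N → ZMod (latticeSize N)) × (ℕ → Node N → Noise N)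

/-- The probability measure of the random network and of the random policy. Initial positions are
uniform; everything is independent. -/
def law (p α : unitInterval) (N : ℕ) : Measure (Sample N) :=
  (configMeasure N).prod
    ((Measure.pi fun _ => uniformOn Set.univ).prod
      (Measure.infinitePi fun _ : ℕ => Measure.pi fun _ => noiseMeasure p α N))

/-- The lattice position of node `i` in time-slot `t`: a natural random walk. -/
def pos {N : ℕ} (ω : Sample N) (t : ℕ) (i : Node N) : ZMod (latticeSize N) :=
  ω.2.1 i + ∑ τ ∈ Finset.range t, (ω.2.2 τ i).step

/-- The point of the sphere at which node `i` is in time-slot `t`. -/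
def location {N : ℕ} (P : Placement N) (ω : Sample N) (t : ℕ) (i : Node N) : E3 :=
  latticePoint P ω.1 i (pos ω t i)

/-- Node `i` is, in time-slot `t`, at a lattice point of its great circle closest to `z`. -/
def AtClosest {N : ℕ} (P : Placement N) (ω : Sample N) (t : ℕ) (i : Node N) (z : E3) : Prop :=
  ∀ l, gdist (location P ω t i) z ≤ gdist (latticePoint P ω.1 i l) z

/-- Nodes `i` and `j` are neighbors in time-slot `t`. -/
def Neighbor {N : ℕ} (P : Placement N) (ω : Sample N) (t : ℕ) (i j : Node N) : Prop :=
  i ≠ j ∧ AtClosest P ω t i (ω.1.meet i j) ∧ AtClosest P ω t j (ω.1.meet i j)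

/-- `j` is the member of `A` that comes first in the ranking `r`; for a uniformly random ranking
it is a uniformly random member of `A`. -/
def Picks {N : ℕ} (r : Equiv.Perm (Node N)) (A : Set (Node N)) (j : Node N) : Prop :=
  j ∈ A ∧ ∀ k ∈ A, r j ≤ r k

/-- The Relaxed Protocol model: if `x` gives the locations of the nodes and `Tx k l` means that `k`
transmits to `l`, then `i` transmits to `j` and this transmission is successful. -/
def Success {N : ℕ} (Δ : ℝ) (x : Node N → E3) (Tx : Node N → Node N → Prop)
    (i j : Node N) : Prop :=
  Tx i j ∧ ∀ k, k ≠ i → (∃ l, Tx k l) → (1 + Δ) * gdist (x i) (x j) ≤ gdist (x k) (x j)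

/-! ### Policy `Σ_n` -/

section Policy

variable {N : ℕ}

/-- In sub-slot A of time-slot `t`, node `i` transmits to node `j`. -/
def TxA (P : Placement N) (ω : Sample N) (t : ℕ) (i j : Node N) : Prop :=
  (∃ c : Fin N, ω.1.src c = i) ∧ (ω.2.2 t i).actA = true ∧ (ω.2.2 t i).sendA = true ∧
    Picks (ω.2.2 t i).rankA {k | Neighbor P ω t i k} j

/-- In sub-slot B of time-slot `t`, node `i` transmits to node `j`, a destination, a packet
for `j`; here `q i c` is the number of packets of S-D pair `c` queued at relay `i`. -/
def TxB (P : Placement N) (ω : Sample N) (t : ℕ) (q : Node N → Fin N → ℕ)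
    (i j : Node N) : Prop :=
  (ω.2.2 t i).actB = true ∧
    Picks (ω.2.2 t i).rankB {k | Neighbor P ω t i k ∧ ∃ c : Fin N, ω.1.dst c = k} j ∧
    ∃ c : Fin N, ω.1.dst c = j ∧ 0 < q i c

open Classical in
/-- The queues after sub-slot A of time-slot `t`, when they were `q` before it. Sources always have
packets to send; a packet sent directly to its destination is delivered, not queued. -/
def afterA (Δ : ℝ) (P : Placement N) (ω : Sample N) (t : ℕ) (q : Node N → Fin N → ℕ) :
    Node N → Fin N → ℕ := fun r c =>
  q r c + if Success Δ (location P ω t) (TxA P ω t) (ω.1.src c) r ∧ r ≠ ω.1.dst c then 1 else 0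

open Classical in
/-- The queues after sub-slot B of time-slot `t`, when they were `q` before it. Since each relay
keeps a separate queue for each S-D pair, the queue lengths do not depend on the (FIFO) order
of service. -/
def afterB (Δ : ℝ) (P : Placement N) (ω : Sample N) (t : ℕ) (q : Node N → Fin N → ℕ) :
    Node N → Fin N → ℕ := fun r c =>
  q r c - if Success Δ (location P ω t) (TxB P ω t q) r (ω.1.dst c) then 1 else 0

/-- The relay queues at the beginning of time-slot `t`. -/
def queue (Δ : ℝ) (P : Placement N) (ω : Sample N) : ℕ → Node N → Fin N → ℕ
  | 0 => fun _ _ => 0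
  | t + 1 => afterB Δ P ω t (afterA Δ P ω t (queue Δ P ω t))

open Classical in
/-- The number of packets of S-D pair `c` that reach the destination in time-slot `t`: one if the
source transmits successfully to the destination in sub-slot A, and one for each relay that
transmits successfully to the destination in sub-slot B. -/
def delivered (Δ : ℝ) (P : Placement N) (ω : Sample N) (t : ℕ) (c : Fin N) : ℕ :=
  (if Success Δ (location P ω t) (TxA P ω t) (ω.1.src c) (ω.1.dst c) then 1 else 0) +
    (Finset.univ.filter fun r : Node N =>
      Success Δ (location P ω t) (TxB P ω t (afterA Δ P ω t (queue Δ P ω t)))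
        r (ω.1.dst c)).card

/-- Bits of S-D pair `c` transferred in `t` time-slots under policy `Σ_n`; a sub-slot has
length `1 / 2`, so a packet has `W / 2` bits. -/
def bitsSigma (Δ W : ℝ) (P : Placement N) (ω : Sample N) (c : Fin N) (t : ℕ) : ℝ :=
  W / 2 * ((∑ τ ∈ Finset.range t, delivered Δ P ω τ c : ℕ) : ℝ)

/-- Bits of S-D pair `c` transferred in `t` time-slots under direct transmission with round-robin
time-division multiplexing: in time-slot `τ` only the source of pair `τ mod N` transmits, to
its destination, so that there is no interference. -/
def bitsDirect (W : ℝ) (c : Fin N) (t : ℕ) : ℝ :=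
  W * (((Finset.range t).filter fun τ => τ % N = (c : ℕ)).card : ℝ)

open Classical in
/-- Bits of S-D pair `c` transferred in `t` time-slots under scheme `Π`. -/
def bitsPi (Δ W a b : ℝ) (P : Placement N) (ω : Sample N) (c : Fin N) (t : ℕ) : ℝ :=
  if ω.1.Typical Δ a b then bitsSigma Δ W P ω c t else bitsDirect W c t

end Policy

/-- A scheme under which `B N ω c t` bits of S-D pair `c` are transferred in `t` time-slots, in the
network of `2 N` nodes with law `μ N`, has throughput `T`: with probability tending to one,
the long-term rate of each S-D pair is at least `T N`. -/
def HasThroughput {Ω : ℕ → Type} [∀ N, MeasurableSpace (Ω N)] (μ : ∀ N, Measure (Ω N))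
    (B : ∀ N, Ω N → Fin N → ℕ → ℝ) (T : ℕ → ℝ) : Prop :=
  Tendsto
    (fun N => μ N {ω | ∀ c : Fin N, T N ≤ liminf (fun t : ℕ => B N ω c t / (t : ℝ)) atTop})
    atTop (𝓝 1)

end

end MobileNet

/-! Fix a typical configuration, a pair `c` and a relay `r` other than its two endpoints. It is
enough that packets of `c` reach `r`, and that `r` is offered service for them, at rates of order
`1/n`: then `r` forwards at a rate of order `1/n`, and summing over the `n - 2` relays gives each
pair a rate of order one, independent of `n`.

The order `1/n` is a stationary probability. Two given nodes sit at prescribed lattice points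
closest to `z i j` with probability `1/m²`, which is at least `1/n`. Their transmission can then be
disturbed only by a node inside the disk around `z i j`, or by the receiver itself transmitting
(`isolated_of_pos_mem`). Each circle has at most `Q` lattice points in the disk, `Q` depending only
on `Δ`, and typicality lets at most `b√n` circles meet the disk. As positions are independent, the
disk is free of third nodes with probability at least `(1 - Q/m)^(b√n)`, which is bounded below by
`exp(-4Qb)` (`le_frequency_isolated`). The coins cost a further constant factor.

Stationary probabilities become almost sure time averages because the joint motion is an irreducible
random walk on a finite group: the Poisson equation turns the centered sum into a martingale plus a
bounded term, and exponential moments with Borel-Cantelli show that the martingale is `o(t)`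
(`ae_tendsto_walk_average`). The queues are not part of this Markov chain. Arrivals and offered
service are bounded below by indicators of positions and coins alone, and a pathwise argument
converts two such rates into a departure rate (`eventually_mul_le_departures`).

Typicality has probability tending to one: a circle meets a disk roughly when its pole lies in a
band whose width is of order `1/√n`, so the counts have mean of order `√n`. Given the poles of `i`
and `j` the other poles are still i.i.d., Chernoff bounds give failure probability `exp(-const·√n)`,
and a union bound over at most `n²` pairs suffices (`exists_pi_badPoles_le`, `law_not_typical_le`).

The upper bound is conservation of packets: a source emits at most one packet per slot. -/

namespace MobileNet

noncomputable section

section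

/-! ### Departures of a queue -/

/-- A lower bound for the departures of a queue in terms of a minorant `a` of its arrivals and a
minorant `s` of the service it is offered. -/
theorem exists_arrivals_add_service_le {q arr dep a s : ℕ → ℕ} (h0 : q 0 = 0)
    (hq : ∀ t, q (t + 1) + dep t = q t + arr t) (ha : ∀ t, a t ≤ arr t)
    (hs : ∀ t, 0 < q t + arr t → s t ≤ dep t) (t : ℕ) :
    ∃ u ≤ t, ∑ τ ∈ Finset.range u, a τ + ∑ τ ∈ Finset.range t, s τ ≤
      ∑ τ ∈ Finset.range t, dep τ + ∑ τ ∈ Finset.range u, s τ := by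
  have hbal : ∀ t, q t + ∑ τ ∈ Finset.range t, dep τ = ∑ τ ∈ Finset.range t, arr τ := by
    intro t
    induction t with
    | zero => simp [h0]
    | succ t ih =>
      rw [Finset.sum_range_succ, Finset.sum_range_succ, ← ih]
      have := hq t
      omega
  induction t with
  | zero => exact ⟨0, le_rfl, by simp⟩
  | succ t ih =>
    -- The witness `u` is the end of the last slot with nothing to serve, or `0` if there is none.
    -- By then all arrivals have departed, and from then on the departures dominate the offered
    -- service.
    by_cases hpos : 0 < q t + arr t
    · obtain ⟨u, hu, h⟩ := ih
      refine ⟨u, by omega, ?_⟩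
      rw [Finset.sum_range_succ _ t, Finset.sum_range_succ _ t]
      have := hs t hpos
      omega
    · refine ⟨t + 1, le_rfl, ?_⟩
      have h1 := hbal (t + 1)
      have h2 := hq t
      have h3 : q (t + 1) = 0 := by omega
      have h4 : ∑ τ ∈ Finset.range (t + 1), a τ ≤ ∑ τ ∈ Finset.range (t + 1), arr τ :=
        Finset.sum_le_sum fun τ _ => ha τ
      omega

/-- The additive constant absorbs the initial segment. A bound valid at every `t` is needed because
it is applied at the uncontrolled time `u ≤ t` at which a queue was last empty. -/
theorem exists_abs_sub_mul_le {f : ℕ → ℝ} {L : ℝ}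
    (h : Tendsto (fun t : ℕ => f t / t) atTop (𝓝 L)) {ε : ℝ} (hε : 0 < ε) :
    ∃ C : ℝ, ∀ t : ℕ, |f t - L * t| ≤ ε * t + C := by
  obtain ⟨T, hT⟩ := (Metric.tendsto_atTop.1 h) ε hε
  refine ⟨∑ t ∈ Finset.range (T + 1), |f t - L * t|, fun t => ?_⟩
  by_cases ht : t < T + 1
  · have h1 : |f t - L * t| ≤ ∑ t ∈ Finset.range (T + 1), |f t - L * t| :=
      Finset.single_le_sum (f := fun t : ℕ => |f t - L * t|) (fun _ _ => abs_nonneg _)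
        (Finset.mem_range.2 ht)
    have : 0 ≤ ε * t := by positivity
    linarith
  · have h1 := hT t (by omega)
    have htpos : (0 : ℝ) < t := by
      have : 0 < t := by omega
      exact_mod_cast this
    rw [Real.dist_eq] at h1
    have h2 : f t - L * t = (f t / t - L) * t := by field_simp
    rw [h2, abs_mul, abs_of_pos htpos]
    have h3 : 0 ≤ ∑ t ∈ Finset.range (T + 1), |f t - L * t| :=
      Finset.sum_nonneg fun _ _ => abs_nonneg _
    nlinarith

/-- If arrivals and offered service have rates above `κ`, so do the departures. -/
theorem eventually_mul_le_departures {q arr dep a s : ℕ → ℕ} (h0 : q 0 = 0)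
    (hq : ∀ t, q (t + 1) + dep t = q t + arr t) (ha : ∀ t, a t ≤ arr t)
    (hs : ∀ t, 0 < q t + arr t → s t ≤ dep t) {A S κ : ℝ}
    (hA : Tendsto (fun t : ℕ => ((∑ τ ∈ Finset.range t, a τ : ℕ) : ℝ) / t) atTop (𝓝 A))
    (hS : Tendsto (fun t : ℕ => ((∑ τ ∈ Finset.range t, s τ : ℕ) : ℝ) / t) atTop (𝓝 S))
    (hκA : κ < A) (hκS : κ < S) :
    ∀ᶠ t : ℕ in atTop, κ * t ≤ ((∑ τ ∈ Finset.range t, dep τ : ℕ) : ℝ) := by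
  set ρ := min A S with hρ
  have hρκ : κ < ρ := lt_min hκA hκS
  -- Three error terms of size at most `ε t` arise (arrivals to `u`, service to `t`, service to
  -- `u`), and three more absorb the constants `C + 2 * C'`.
  set ε := (ρ - κ) / 6 with hε
  have hε0 : 0 < ε := by rw [hε]; linarith
  obtain ⟨C, hC⟩ := exists_abs_sub_mul_le hA hε0
  obtain ⟨C', hC'⟩ := exists_abs_sub_mul_le hS hε0
  have hlim : ∀ᶠ t : ℕ in atTop, C + 2 * C' ≤ 3 * ε * t := by
    have : Tendsto (fun t : ℕ => 3 * ε * (t : ℝ)) atTop atTop :=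
      tendsto_natCast_atTop_atTop.const_mul_atTop (by positivity)
    exact this.eventually_ge_atTop _
  filter_upwards [hlim] with t ht
  obtain ⟨u, hu, h⟩ := exists_arrivals_add_service_le h0 hq ha hs t
  have h' : ((∑ τ ∈ Finset.range u, a τ : ℕ) : ℝ) + ((∑ τ ∈ Finset.range t, s τ : ℕ) : ℝ) ≤
      ((∑ τ ∈ Finset.range t, dep τ : ℕ) : ℝ) + ((∑ τ ∈ Finset.range u, s τ : ℕ) : ℝ) := by
    exact_mod_cast h
  have h1 := (abs_le.1 (hC u)).1
  have h2 := (abs_le.1 (hC' t)).1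
  have h3 := (abs_le.1 (hC' u)).2
  have hut : (u : ℝ) ≤ t := by exact_mod_cast hu
  have hu0 : (0 : ℝ) ≤ u := by positivity
  have h4 : ρ * u ≤ A * u := mul_le_mul_of_nonneg_right (min_le_left _ _) hu0
  have h5 : ρ * (t - u) ≤ S * (t - u) :=
    mul_le_mul_of_nonneg_right (min_le_right _ _) (by linarith)
  have h6 : ε * u ≤ ε * t := mul_le_mul_of_nonneg_left hut hε0.le
  have h7 : ρ = κ + 6 * ε := by rw [hε]; ring
  nlinarith

/-! ### Packet balance of the policy -/

variable {N : ℕ}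

theorem Picks.unique {r : Equiv.Perm (Node N)} {A : Set (Node N)} {j k : Node N}
    (hj : Picks r A j) (hk : Picks r A k) : j = k :=
  r.injective (le_antisymm (hj.2 k hk.1) (hk.2 j hj.1))

theorem Config.dst_injective (s : Config N) : Function.Injective s.dst := by
  intro c d h
  have := s.2.1.injective h
  simpa using this

theorem Config.src_ne_dst (s : Config N) (c d : Fin N) : s.src c ≠ s.dst d := by
  intro h
  have := s.2.1.injective h
  simp at this

open Classical in
/-- Arrivals at relay `r` of packets of pair `c` in time-slot `t`. -/
def arrivals (Δ : ℝ) (P : Placement N) (ω : Sample N) (r : Node N) (c : Fin N) (t : ℕ) : ℕ :=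
  if Success Δ (location P ω t) (TxA P ω t) (ω.1.src c) r ∧ r ≠ ω.1.dst c then 1 else 0

open Classical in
/-- Departures from relay `r` of packets of pair `c` in time-slot `t`. -/
def departures (Δ : ℝ) (P : Placement N) (ω : Sample N) (r : Node N) (c : Fin N) (t : ℕ) : ℕ :=
  if Success Δ (location P ω t) (TxB P ω t (afterA Δ P ω t (queue Δ P ω t))) r (ω.1.dst c)
    then 1 else 0

theorem queue_balance (Δ : ℝ) (P : Placement N) (ω : Sample N) (r : Node N) (c : Fin N) (t : ℕ) :
    queue Δ P ω (t + 1) r c + departures Δ P ω r c t =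
      queue Δ P ω t r c + arrivals Δ P ω r c t := by
  have hA : afterA Δ P ω t (queue Δ P ω t) r c =
      queue Δ P ω t r c + arrivals Δ P ω r c t := rfl
  have hB : queue Δ P ω (t + 1) r c =
      afterA Δ P ω t (queue Δ P ω t) r c - departures Δ P ω r c t := rfl
  -- The truncated subtraction in `afterB` loses nothing: a relay transmits only from a nonempty
  -- queue, and the destination determines the pair.
  have hle : departures Δ P ω r c t ≤ afterA Δ P ω t (queue Δ P ω t) r c := by
    unfold departures
    split_ifs with h
    · obtain ⟨_, _, d, hd, hpos⟩ := h.1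
      rwa [ω.1.dst_injective hd] at hpos
    · exact Nat.zero_le _
  omega

theorem queue_add_sum_departures (Δ : ℝ) (P : Placement N) (ω : Sample N) (r : Node N) (c : Fin N)
    (t : ℕ) : queue Δ P ω t r c + ∑ τ ∈ Finset.range t, departures Δ P ω r c τ =
      ∑ τ ∈ Finset.range t, arrivals Δ P ω r c τ := by
  induction t with
  | zero => simp [queue]
  | succ t ih =>
    rw [Finset.sum_range_succ, Finset.sum_range_succ, ← ih]
    have := queue_balance Δ P ω r c t
    omega

open Classical in
theorem delivered_eq (Δ : ℝ) (P : Placement N) (ω : Sample N) (t : ℕ) (c : Fin N) :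
    delivered Δ P ω t c =
      (if Success Δ (location P ω t) (TxA P ω t) (ω.1.src c) (ω.1.dst c) then 1 else 0) +
        ∑ r, departures Δ P ω r c t := by
  simp [delivered, departures, Finset.sum_boole]

open Classical in
/-- A source sends at most one packet in a time-slot. -/
theorem direct_add_sum_arrivals_le (Δ : ℝ) (P : Placement N) (ω : Sample N) (t : ℕ) (c : Fin N) :
    (if Success Δ (location P ω t) (TxA P ω t) (ω.1.src c) (ω.1.dst c) then 1 else 0) +
      ∑ r, arrivals Δ P ω r c t ≤ 1 := by
  by_cases h : ∃ r, Success Δ (location P ω t) (TxA P ω t) (ω.1.src c) r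
  · obtain ⟨r₀, hr₀⟩ := h
    have huniq : ∀ r, Success Δ (location P ω t) (TxA P ω t) (ω.1.src c) r → r = r₀ :=
      fun r hr => Picks.unique hr.1.2.2.2 hr₀.1.2.2.2
    by_cases hd : r₀ = ω.1.dst c
    · have : ∀ r, arrivals Δ P ω r c t = 0 := by
        intro r
        unfold arrivals
        rw [if_neg]
        rintro ⟨h1, h2⟩
        exact h2 ((huniq r h1).trans hd)
      simp only [this, Finset.sum_const_zero, add_zero]
      split_ifs <;> simp
    · rw [if_neg (fun h => hd (huniq _ h).symm), zero_add, Finset.sum_eq_single r₀]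
      · unfold arrivals
        split_ifs <;> simp
      · intro r _ hr
        unfold arrivals
        rw [if_neg]
        rintro ⟨h1, _⟩
        exact hr (huniq r h1)
      · simp
  · push Not at h
    simp [h, arrivals]

/-- Relays start empty, so what they forward does not exceed what they received; together with the
direct deliveries this is at most what the source sent. -/
theorem sum_delivered_le (Δ : ℝ) (P : Placement N) (ω : Sample N) (t : ℕ) (c : Fin N) :
    ∑ τ ∈ Finset.range t, delivered Δ P ω τ c ≤ t := by
  classical
  have h1 : ∑ τ ∈ Finset.range t, ∑ r, departures Δ P ω r c τ ≤
      ∑ τ ∈ Finset.range t, ∑ r, arrivals Δ P ω r c τ := by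
    rw [Finset.sum_comm, Finset.sum_comm (s := Finset.range t)]
    refine Finset.sum_le_sum fun r _ => ?_
    have := queue_add_sum_departures Δ P ω r c t
    omega
  calc ∑ τ ∈ Finset.range t, delivered Δ P ω τ c
      ≤ ∑ τ ∈ Finset.range t,
          ((if Success Δ (location P ω τ) (TxA P ω τ) (ω.1.src c) (ω.1.dst c) then 1 else 0) +
            ∑ r, arrivals Δ P ω r c τ) := by
        simp only [delivered_eq, Finset.sum_add_distrib]
        exact Nat.add_le_add_left h1 _
    _ ≤ ∑ τ ∈ Finset.range t, 1 :=
        Finset.sum_le_sum fun τ _ => direct_add_sum_arrivals_le Δ P ω τ c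
    _ = t := by simp

theorem bitsPi_nonneg {W : ℝ} (hW : 0 ≤ W) (Δ a b : ℝ) (P : Placement N) (ω : Sample N)
    (c : Fin N) (t : ℕ) : 0 ≤ bitsPi Δ W a b P ω c t := by
  unfold bitsPi bitsSigma bitsDirect
  split_ifs <;> positivity

theorem bitsPi_le {W : ℝ} (hW : 0 ≤ W) (Δ a b : ℝ) (P : Placement N) (ω : Sample N)
    (c : Fin N) (t : ℕ) : bitsPi Δ W a b P ω c t ≤ W * t := by
  unfold bitsPi bitsSigma bitsDirect
  split_ifs
  · have h : ((∑ τ ∈ Finset.range t, delivered Δ P ω τ c : ℕ) : ℝ) ≤ t := by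
      exact_mod_cast sum_delivered_le Δ P ω t c
    have h0 : (0 : ℝ) ≤ t := by positivity
    nlinarith [mul_le_mul_of_nonneg_left h hW, mul_nonneg hW h0]
  · refine mul_le_mul_of_nonneg_left ?_ hW
    have : ((Finset.range t).filter fun τ => τ % N = (c : ℕ)).card ≤ t := by
      simpa using Finset.card_filter_le (Finset.range t) fun τ => τ % N = (c : ℕ)
    exact_mod_cast this

/-- Both bounds are needed for comparisons with a real-valued `liminf`, which require boundedness on
one side or the other. -/
theorem bitsPi_div_mem_Icc {W : ℝ} (hW : 0 ≤ W) (Δ a b : ℝ) (P : Placement N) (ω : Sample N)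
    (c : Fin N) (t : ℕ) : bitsPi Δ W a b P ω c t / t ∈ Set.Icc 0 W := by
  refine ⟨div_nonneg (bitsPi_nonneg hW ..) (by positivity), ?_⟩
  rcases Nat.eq_zero_or_pos t with rfl | ht
  · simpa using hW
  · rw [div_le_iff₀ (by exact_mod_cast ht)]
    exact bitsPi_le hW ..

theorem liminf_bitsPi_le {W : ℝ} (hW : 0 ≤ W) (Δ a b : ℝ) (P : Placement N) (ω : Sample N)
    (c : Fin N) : liminf (fun t : ℕ => bitsPi Δ W a b P ω c t / t) atTop ≤ W := by
  refine liminf_le_of_le ?_ fun x hx => ?_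
  · exact isBoundedUnder_of ⟨0, fun t => (bitsPi_div_mem_Icc hW Δ a b P ω c t).1⟩
  · obtain ⟨t, ht⟩ := hx.exists
    exact ht.trans (bitsPi_div_mem_Icc hW Δ a b P ω c t).2

theorem le_liminf_bitsPi {W : ℝ} (hW : 0 ≤ W) (Δ a b : ℝ) (P : Placement N) (ω : Sample N)
    (c : Fin N) {x : ℝ} (h : ∀ᶠ t : ℕ in atTop, x ≤ bitsPi Δ W a b P ω c t / t) :
    x ≤ liminf (fun t : ℕ => bitsPi Δ W a b P ω c t / t) atTop :=
  le_liminf_of_le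
    (isBoundedUnder_of ⟨W, fun t => (bitsPi_div_mem_Icc hW Δ a b P ω c t).2⟩).isCoboundedUnder_ge h

/-- The rate of every pair is bounded by `W`, so that this bounds every throughput. -/
theorem eventually_le_of_hasThroughput {W : ℝ} (hW : 0 ≤ W) (Δ a b : ℝ) (p α : unitInterval)
    (P : ∀ N, Placement N) {T : ℕ → ℝ}
    (hT : HasThroughput (law p α) (fun N => bitsPi Δ W a b (P N)) T) :
    ∀ᶠ N in atTop, T N ≤ W := by
  filter_upwards [hT.eventually (lt_mem_nhds (show (0 : ENNReal) < 1 from one_pos)),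
    eventually_ge_atTop 1] with N hN hN1
  obtain ⟨ω, hω⟩ := nonempty_of_measure_ne_zero hN.ne'
  exact (hω ⟨0, hN1⟩).trans (liminf_bitsPi_le hW Δ a b (P N) ω _)

end

section

/-! ### The Poisson equation for a random walk on a finite group -/

section Walk

variable {G Ξ : Type*} [Fintype G] [AddCommGroup G] [Fintype Ξ]

/-- A function that is harmonic for an irreducible random walk on a finite group is constant. -/
theorem eq_of_harmonic {w : Ξ → ℝ} {step : Ξ → G} (hw : ∀ ξ, 0 < w ξ) (hw1 : ∑ ξ, w ξ = 1)
    (hgen : ∀ A : Set G, A.Nonempty → (∀ x ∈ A, ∀ ξ, x + step ξ ∈ A) → A = Set.univ)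
    {g : G → ℝ} (hg : ∀ x, g x = ∑ ξ, w ξ * g (x + step ξ)) (x y : G) : g x = g y := by
  obtain ⟨z, hz⟩ := Finite.exists_max g
  have hA : {x | g x = g z} = Set.univ := by
    refine hgen _ ⟨z, rfl⟩ fun x hx ξ => ?_
    have hx : g x = g z := hx
    by_contra hne
    have hlt : g (x + step ξ) < g z := lt_of_le_of_ne (hz _) hne
    have h1 : ∑ ξ, w ξ * g (x + step ξ) < ∑ ξ, w ξ * g z :=
      Finset.sum_lt_sum (fun ξ _ => mul_le_mul_of_nonneg_left (hz _) (hw ξ).le)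
        ⟨ξ, Finset.mem_univ _, mul_lt_mul_of_pos_left hlt (hw ξ)⟩
    rw [← hg, ← Finset.sum_mul, hw1, one_mul, hx] at h1
    exact lt_irrefl _ h1
  have hx : x ∈ {x | g x = g z} := hA ▸ Set.mem_univ x
  have hy : y ∈ {x | g x = g z} := hA ▸ Set.mem_univ y
  exact Eq.trans hx (Eq.symm hy)

/-- Rank-nullity for `T = 1 - (transition operator)`. Translation invariance makes counting measure
stationary, so the range of `T` lies in the functions of sum zero. By the maximum principle the
kernel is at most the constants, so the range has codimension at most one and must be that whole
hyperplane. -/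
theorem exists_poisson {w : Ξ → ℝ} {step : Ξ → G} (hw : ∀ ξ, 0 < w ξ) (hw1 : ∑ ξ, w ξ = 1)
    (hgen : ∀ A : Set G, A.Nonempty → (∀ x ∈ A, ∀ ξ, x + step ξ ∈ A) → A = Set.univ)
    {F : G → ℝ} (hF : ∑ x, F x = 0) :
    ∃ g : G → ℝ, ∀ x, F x = g x - ∑ ξ, w ξ * g (x + step ξ) := by
  classical
  let T : (G → ℝ) →ₗ[ℝ] (G → ℝ) :=
    { toFun := fun g x => g x - ∑ ξ, w ξ * g (x + step ξ)
      map_add' := by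
        intro g h
        ext x
        simp only [Pi.add_apply, mul_add, Finset.sum_add_distrib]
        ring
      map_smul' := by
        intro c g
        ext x
        simp only [Pi.smul_apply, smul_eq_mul, RingHom.id_apply, mul_sub, Finset.mul_sum]
        congr 1
        exact Finset.sum_congr rfl fun ξ _ => by ring }
  let σ : (G → ℝ) →ₗ[ℝ] ℝ := ∑ x, LinearMap.proj x
  have hσ : ∀ g, σ g = ∑ x, g x := fun g => by simp [σ]
  have hTσ : LinearMap.range T ≤ LinearMap.ker σ := by
    rintro _ ⟨g, rfl⟩
    rw [LinearMap.mem_ker, hσ]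
    change ∑ x, (g x - ∑ ξ, w ξ * g (x + step ξ)) = 0
    rw [Finset.sum_sub_distrib, Finset.sum_comm]
    have : ∀ ξ, ∑ x, w ξ * g (x + step ξ) = w ξ * ∑ x, g x := by
      intro ξ
      rw [← Finset.mul_sum]
      congr 1
      exact Fintype.sum_equiv (Equiv.addRight (step ξ)) _ _ fun x => rfl
    simp only [this]
    rw [← Finset.sum_mul, hw1, one_mul, sub_self]
  have hker : LinearMap.ker T ≤ Submodule.span ℝ {fun _ => (1 : ℝ)} := by
    intro g hg
    have hg' : ∀ x, g x = ∑ ξ, w ξ * g (x + step ξ) := fun x => by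
      have : T g x = 0 := by rw [LinearMap.mem_ker.1 hg]; rfl
      exact sub_eq_zero.1 this
    refine Submodule.mem_span_singleton.2 ⟨g 0, ?_⟩
    ext x
    simpa using eq_of_harmonic hw hw1 hgen hg' 0 x
  have hker1 : Module.finrank ℝ (LinearMap.ker T) ≤ 1 :=
    (Submodule.finrank_mono hker).trans (by simpa using finrank_span_le_card (R := ℝ) ({fun _ => 1} : Set (G → ℝ)))
  have hσsurj : LinearMap.range σ = ⊤ := by
    refine LinearMap.range_eq_top.2 fun c => ⟨Pi.single 0 c, ?_⟩
    rw [hσ]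
    simp
  have h1 := LinearMap.finrank_range_add_finrank_ker T
  have h2 := LinearMap.finrank_range_add_finrank_ker σ
  rw [hσsurj, finrank_top, Module.finrank_self] at h2
  have heq : LinearMap.range T = LinearMap.ker σ :=
    Submodule.eq_of_le_of_finrank_le hTσ (by omega)
  have hFmem : F ∈ LinearMap.range T := by
    rw [heq, LinearMap.mem_ker, hσ, hF]
  obtain ⟨g, hg⟩ := hFmem
  exact ⟨g, fun x => by rw [← hg]; rfl⟩

end Walk

/-! ### Ergodic averages of a random walk on a finite group -/

section Ergodic

variable {G Ξ : Type} [AddCommGroup G]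

/-- A random walk with steps driven by the sequence `ω`, started at `x`. -/
def walk (step : Ξ → G) (x : G) (ω : ℕ → Ξ) (t : ℕ) : G := x + ∑ τ ∈ Finset.range t, step (ω τ)

theorem walk_succ (step : Ξ → G) (x : G) (ω : ℕ → Ξ) (t : ℕ) :
    walk step x ω (t + 1) = walk step x ω t + step (ω t) := by
  simp [walk, Finset.sum_range_succ, add_assoc]

/-- A functional of the first `T` coordinates factors through a finite type. -/
theorem exists_factor_of_dependsOn {f : (ℕ → Ξ) → ℝ} {T : ℕ} [Nonempty Ξ]
    (hf : ∀ ω ω', (∀ t < T, ω t = ω' t) → f ω = f ω') :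
    ∃ Φ : (Finset.range T → Ξ) → ℝ, ∀ ω, f ω = Φ fun i => ω i := by
  classical
  obtain ⟨ξ₀⟩ := ‹Nonempty Ξ›
  refine ⟨fun y => f fun t => if ht : t ∈ Finset.range T then y ⟨t, ht⟩ else ξ₀, fun ω => ?_⟩
  refine hf _ _ fun t ht => ?_
  simp [ht]

/-- The martingale with increments `h` along a random walk. -/
def walkSum (step : Ξ → G) (x : G) (h : G → Ξ → ℝ) (T : ℕ) (ω : ℕ → Ξ) : ℝ :=
  ∑ t ∈ Finset.range T, h (walk step x ω t) (ω t)

theorem walk_congr (step : Ξ → G) (x : G) {T : ℕ} {ω ω' : ℕ → Ξ} (h : ∀ t < T, ω t = ω' t) :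
    walk step x ω T = walk step x ω' T := by
  unfold walk
  congr 1
  exact Finset.sum_congr rfl fun t ht => by rw [h t (Finset.mem_range.1 ht)]

theorem walkSum_congr (step : Ξ → G) (x : G) (k : G → Ξ → ℝ) {T : ℕ} {ω ω' : ℕ → Ξ}
    (h : ∀ t < T, ω t = ω' t) : walkSum step x k T ω = walkSum step x k T ω' := by
  unfold walkSum
  refine Finset.sum_congr rfl fun t ht => ?_
  have ht := Finset.mem_range.1 ht
  rw [h t ht, walk_congr step x fun s hs => h s (hs.trans ht)]

variable [Fintype G] [Fintype Ξ] [MeasurableSpace Ξ] [DiscreteMeasurableSpace Ξ]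
  {ν : Measure Ξ} [IsProbabilityMeasure ν]

theorem integrable_of_dependsOn {f : (ℕ → Ξ) → ℝ} {T : ℕ}
    (hf : ∀ ω ω', (∀ t < T, ω t = ω' t) → f ω = f ω') :
    Integrable f (Measure.infinitePi fun _ : ℕ => ν) := by
  have : Nonempty Ξ := nonempty_of_isProbabilityMeasure ν
  obtain ⟨Φ, hΦ⟩ := exists_factor_of_dependsOn hf
  have hfΦ : f = Φ ∘ fun ω (i : Finset.range T) => ω i := funext hΦ
  have hm : Measurable fun (ω : ℕ → Ξ) (i : Finset.range T) => ω i := by fun_prop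
  rw [hfΦ]
  have hmeas : Measurable Φ := measurable_of_finite _
  refine Integrable.of_bound (C := ∑ y, |Φ y|) (hmeas.comp hm).aestronglyMeasurable ?_
  refine Eventually.of_forall fun ω => ?_
  exact Finset.single_le_sum (f := fun y => |Φ y|) (fun _ _ => abs_nonneg _) (Finset.mem_univ _)

/-- The Markov property in the only form required: coordinate `T` is independent of a functional of
the earlier ones. No filtration or conditional expectation is used. -/
theorem integral_mul_next {f : (ℕ → Ξ) → ℝ} {T : ℕ}
    (hf : ∀ ω ω', (∀ t < T, ω t = ω' t) → f ω = f ω') (φ : Ξ → ℝ) :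
    ∫ ω, f ω * φ (ω T) ∂(Measure.infinitePi fun _ : ℕ => ν) =
      (∫ ω, f ω ∂(Measure.infinitePi fun _ : ℕ => ν)) * ∫ ξ, φ ξ ∂ν := by
  have : Nonempty Ξ := nonempty_of_isProbabilityMeasure ν
  obtain ⟨Φ, hΦ⟩ := exists_factor_of_dependsOn hf
  have hind : iIndepFun (fun (t : ℕ) (ω : ℕ → Ξ) => ω t) (Measure.infinitePi fun _ : ℕ => ν) :=
    iIndepFun_infinitePi (P := fun _ : ℕ => ν) (X := fun _ ξ => ξ) (fun _ => measurable_id)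
  have h2 := hind.indepFun_finset (Finset.range T) {T} (by simp) (fun t => by fun_prop)
  have h3 : IndepFun f (fun ω : ℕ → Ξ => φ (ω T)) (Measure.infinitePi fun _ : ℕ => ν) := by
    have := h2.comp (φ := Φ) (ψ := fun y => φ (y ⟨T, by simp⟩)) (measurable_of_finite _)
      (measurable_of_finite _)
    rwa [show f = Φ ∘ fun ω (i : Finset.range T) => ω i from funext hΦ]
  have hφ : Measurable φ := measurable_of_finite _
  rw [h3.integral_fun_mul_eq_mul_integral (integrable_of_dependsOn (ν := ν) hf).1
    (hφ.comp (measurable_pi_apply T)).aestronglyMeasurable]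
  congr 1
  have hmp := measurePreserving_eval_infinitePi (fun _ : ℕ => ν) T
  have := integral_map (μ := Measure.infinitePi fun _ : ℕ => ν) hmp.aemeasurable
    hφ.aestronglyMeasurable
  rw [hmp.map_eq] at this
  exact this.symm

/-- Each step multiplies the exponential moment by at most `K`. Conditioning on the position at time
`T` is done by splitting the integrand over the finitely many values `y` of that position, after
which the new increment depends on `ω T` alone. -/
theorem integral_exp_walkSum_le (step : Ξ → G) (x : G) {h : G → Ξ → ℝ} {K : ℝ}
    (hK : ∀ y, ∫ ξ, Real.exp (h y ξ) ∂ν ≤ K) (hK0 : 0 ≤ K) (T : ℕ) :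
    ∫ ω, Real.exp (walkSum step x h T ω) ∂(Measure.infinitePi fun _ : ℕ => ν) ≤ K ^ T := by
  classical
  induction T with
  | zero => simp [walkSum]
  | succ T ih =>
    set f : G → (ℕ → Ξ) → ℝ := fun y ω =>
      if walk step x ω T = y then Real.exp (walkSum step x h T ω) else 0 with hf
    have hfd : ∀ y ω ω', (∀ t < T, ω t = ω' t) → f y ω = f y ω' := by
      intro y ω ω' hω
      simp only [hf, walk_congr step x hω, walkSum_congr step x h hω]
    have hsum : ∀ ω, Real.exp (walkSum step x h T ω) = ∑ y, f y ω := by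
      intro ω
      simp [hf]
    have hnext : ∀ ω, Real.exp (walkSum step x h (T + 1) ω) =
        ∑ y, f y ω * Real.exp (h y (ω T)) := by
      intro ω
      simp only [hf, ite_mul, zero_mul, Finset.sum_ite_eq, Finset.mem_univ, if_true]
      rw [← Real.exp_add]
      simp [walkSum, Finset.sum_range_succ]
    have hint : ∀ y, Integrable (fun ω : ℕ → Ξ => f y ω * Real.exp (h y (ω T)))
        (Measure.infinitePi fun _ : ℕ => ν) := by
      intro y
      refine integrable_of_dependsOn (T := T + 1) fun ω ω' hω => ?_
      rw [hfd y ω ω' fun t ht => hω t (by omega), hω T (by omega)]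
    simp only [hnext]
    rw [integral_finsetSum _ fun y _ => hint y]
    calc ∑ y, ∫ ω, f y ω * Real.exp (h y (ω T)) ∂(Measure.infinitePi fun _ : ℕ => ν)
        = ∑ y, (∫ ω, f y ω ∂(Measure.infinitePi fun _ : ℕ => ν)) * ∫ ξ, Real.exp (h y ξ) ∂ν :=
          Finset.sum_congr rfl fun y _ =>
            integral_mul_next (hfd y) fun ξ => Real.exp (h y ξ)
      _ ≤ ∑ y, (∫ ω, f y ω ∂(Measure.infinitePi fun _ : ℕ => ν)) * K := by
          refine Finset.sum_le_sum fun y _ => mul_le_mul_of_nonneg_left (hK y) ?_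
          refine integral_nonneg fun ω => ?_
          simp only [hf, Pi.zero_apply]
          split_ifs <;> positivity
      _ = (∫ ω, Real.exp (walkSum step x h T ω) ∂(Measure.infinitePi fun _ : ℕ => ν)) * K := by
          simp only [hsum]
          rw [integral_finsetSum _ fun y _ => integrable_of_dependsOn (hfd y), Finset.sum_mul]
      _ ≤ K ^ T * K := mul_le_mul_of_nonneg_right ih hK0
      _ = K ^ (T + 1) := (pow_succ K T).symm

/-- Integrate `exp x ≤ 1 + x + x²`, valid for `|x| ≤ 1`; the linear term vanishes. -/
theorem integral_exp_le_of_integral_eq_zero {φ : Ξ → ℝ} (h0 : ∫ ξ, φ ξ ∂ν = 0) {B : ℝ}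
    (hB : ∀ ξ, |φ ξ| ≤ B) (hB1 : B ≤ 1) : ∫ ξ, Real.exp (φ ξ) ∂ν ≤ 1 + B ^ 2 := by
  have hle : ∀ ξ, Real.exp (φ ξ) ≤ 1 + φ ξ + B ^ 2 := by
    intro ξ
    have h1 := (abs_le.1 (Real.abs_exp_sub_one_sub_id_le ((hB ξ).trans hB1))).2
    have h2 : φ ξ ^ 2 ≤ B ^ 2 := sq_le_sq' (abs_le.1 (hB ξ)).1 (abs_le.1 (hB ξ)).2
    linarith
  have hi : ∀ ψ : Ξ → ℝ, Integrable ψ ν := fun ψ => Integrable.of_finite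
  calc ∫ ξ, Real.exp (φ ξ) ∂ν ≤ ∫ ξ, (1 + φ ξ + B ^ 2) ∂ν :=
        integral_mono (hi _) (hi _) hle
    _ = 1 + B ^ 2 := by
        rw [integral_add (hi _) (hi _), integral_add (hi _) (hi _), h0]
        simp

/-- A Chernoff bound makes the probability of exceeding `δ T` decay geometrically in `T`, and
Borel-Cantelli concludes. -/
theorem ae_eventually_walkSum_le (step : Ξ → G) (x : G) {h : G → Ξ → ℝ}
    (h0 : ∀ y, ∫ ξ, h y ξ ∂ν = 0) {δ : ℝ} (hδ : 0 < δ) :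
    ∀ᵐ ω ∂(Measure.infinitePi fun _ : ℕ => ν),
      ∀ᶠ T : ℕ in atTop, walkSum step x h T ω ≤ δ * T := by
  set μ := Measure.infinitePi fun _ : ℕ => ν with hμ
  obtain ⟨B, hB1, hB⟩ : ∃ B : ℝ, 1 ≤ B ∧ ∀ y ξ, |h y ξ| ≤ B := by
    refine ⟨1 + ∑ y, ∑ ξ, |h y ξ|, ?_, fun y ξ => ?_⟩
    · have : 0 ≤ ∑ y, ∑ ξ, |h y ξ| :=
        Finset.sum_nonneg fun _ _ => Finset.sum_nonneg fun _ _ => abs_nonneg _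
      linarith
    · have h1 : |h y ξ| ≤ ∑ ξ, |h y ξ| :=
        Finset.single_le_sum (f := fun ξ => |h y ξ|) (fun _ _ => abs_nonneg _)
          (Finset.mem_univ ξ)
      have h2 : ∑ ξ, |h y ξ| ≤ ∑ y, ∑ ξ, |h y ξ| :=
        Finset.single_le_sum (f := fun y => ∑ ξ, |h y ξ|)
          (fun _ _ => Finset.sum_nonneg fun _ _ => abs_nonneg _) (Finset.mem_univ y)
      linarith
  -- The exponent `l² B² - l δ` is to be negative: `l = η / (2 B²)` makes its first term `l η / 2`.
  -- Capping `η` at `1` ensures `l B ≤ 1`, the range of the quadratic bound on `exp`.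
  set η := min δ 1 with hη
  have hη0 : 0 < η := lt_min hδ one_pos
  set l := η / (2 * B ^ 2) with hl
  have hBpos : 0 < B := by linarith
  have hl0 : 0 < l := by positivity
  have hlB : l * B ≤ 1 := by
    rw [hl, div_mul_eq_mul_div, div_le_one (by positivity)]
    have : η ≤ 1 := min_le_right _ _
    nlinarith
  have hK : ∀ y, ∫ ξ, Real.exp (l * h y ξ) ∂ν ≤ Real.exp (l ^ 2 * B ^ 2) := by
    intro y
    have h1 : ∫ ξ, l * h y ξ ∂ν = 0 := by rw [integral_const_mul, h0, mul_zero]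
    have h2 := integral_exp_le_of_integral_eq_zero (ν := ν) h1 (B := l * B) (fun ξ => by
      rw [abs_mul, abs_of_pos hl0]
      exact mul_le_mul_of_nonneg_left (hB y ξ) hl0.le) hlB
    have h3 := Real.add_one_le_exp (l ^ 2 * B ^ 2)
    rw [mul_pow] at h2
    linarith
  have hrate : l ^ 2 * B ^ 2 - l * δ ≤ -(l * η / 2) := by
    have h1 : l ^ 2 * B ^ 2 = l * η / 2 := by
      rw [hl]; field_simp
    have h2 : l * η ≤ l * δ := mul_le_mul_of_nonneg_left (min_le_left _ _) hl0.le
    linarith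
  have htail : ∀ T : ℕ, μ {ω | δ * T ≤ walkSum step x h T ω} ≤
      ENNReal.ofReal (Real.exp (-(l * η / 2)) ^ T) := by
    intro T
    have hdep : ∀ ω ω' : ℕ → Ξ, (∀ t < T, ω t = ω' t) →
        Real.exp (l * walkSum step x h T ω) = Real.exp (l * walkSum step x h T ω') :=
      fun ω ω' hω => by rw [walkSum_congr step x h hω]
    have h1 := measure_ge_le_exp_mul_mgf (μ := μ) (X := walkSum step x h T) (δ * T) hl0.le
      (integrable_of_dependsOn hdep)
    have h2 : mgf (walkSum step x h T) μ l ≤ Real.exp (l ^ 2 * B ^ 2) ^ T := by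
      have h3 := integral_exp_walkSum_le step x hK (Real.exp_pos _).le T
      have h4 : ∀ ω, walkSum step x (fun y ξ => l * h y ξ) T ω = l * walkSum step x h T ω := by
        intro ω
        simp [walkSum, Finset.mul_sum]
      simp only [h4] at h3
      exact h3
    rw [← ofReal_measureReal]
    refine ENNReal.ofReal_le_ofReal (h1.trans ?_)
    refine (mul_le_mul_of_nonneg_left h2 (Real.exp_pos _).le).trans ?_
    rw [← Real.exp_nat_mul, ← Real.exp_nat_mul, ← Real.exp_add]
    refine Real.exp_le_exp.2 ?_
    have hT : (0 : ℝ) ≤ T := by positivity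
    nlinarith
  have hsum : ∑' T : ℕ, μ {ω | δ * T ≤ walkSum step x h T ω} ≠ ⊤ := by
    have hr : Real.exp (-(l * η / 2)) < 1 := by
      rw [Real.exp_lt_one_iff]
      have : 0 < l * η / 2 := by positivity
      linarith
    have hs := summable_geometric_of_lt_one (Real.exp_pos _).le hr
    refine ne_top_of_le_ne_top ?_ (ENNReal.tsum_le_tsum htail)
    rw [← ENNReal.ofReal_tsum_of_nonneg (fun T => by positivity) hs]
    exact ENNReal.ofReal_ne_top
  filter_upwards [ae_eventually_notMem hsum] with ω hω
  filter_upwards [hω] with T hT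
  exact (not_le.1 hT).le

theorem ae_tendsto_walkSum_div (step : Ξ → G) (x : G) {h : G → Ξ → ℝ}
    (h0 : ∀ y, ∫ ξ, h y ξ ∂ν = 0) :
    ∀ᵐ ω ∂(Measure.infinitePi fun _ : ℕ => ν),
      Tendsto (fun T : ℕ => walkSum step x h T ω / T) atTop (𝓝 0) := by
  have h1 : ∀ᵐ ω ∂(Measure.infinitePi fun _ : ℕ => ν), ∀ k : ℕ,
      ∀ᶠ T : ℕ in atTop, walkSum step x h T ω ≤ 1 / ((k : ℝ) + 1) * T :=
    ae_all_iff.2 fun k => ae_eventually_walkSum_le step x h0 (by positivity)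
  have h2 : ∀ᵐ ω ∂(Measure.infinitePi fun _ : ℕ => ν), ∀ k : ℕ,
      ∀ᶠ T : ℕ in atTop, walkSum step x (fun y ξ => -h y ξ) T ω ≤ 1 / ((k : ℝ) + 1) * T :=
    ae_all_iff.2 fun k => ae_eventually_walkSum_le step x
      (fun y => by rw [integral_neg, h0, neg_zero]) (by positivity)
  filter_upwards [h1, h2] with ω hω1 hω2
  rw [Metric.tendsto_atTop']
  intro ε hε
  obtain ⟨k, hk⟩ := exists_nat_one_div_lt hε
  have := (hω1 k).and ((hω2 k).and (eventually_gt_atTop 0))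
  obtain ⟨T₀, hT₀⟩ := eventually_atTop.1 this
  refine ⟨T₀, fun T hT => ?_⟩
  obtain ⟨h3, h4, h5⟩ := hT₀ T hT.le
  have hTpos : (0 : ℝ) < T := by exact_mod_cast h5
  have h6 : walkSum step x (fun y ξ => -h y ξ) T ω = -walkSum step x h T ω := by
    simp [walkSum]
  rw [h6] at h4
  rw [Real.dist_eq, sub_zero, abs_div, abs_of_pos hTpos]
  refine lt_of_le_of_lt ?_ hk
  rw [div_le_iff₀ hTpos]
  exact abs_le.2 ⟨by linarith, h3⟩

/-- The ergodic theorem for an irreducible random walk on a finite group. -/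
theorem ae_tendsto_walk_average (hν : ∀ ξ, 0 < ν.real {ξ}) (step : Ξ → G)
    (hgen : ∀ A : Set G, A.Nonempty → (∀ x ∈ A, ∀ ξ, x + step ξ ∈ A) → A = Set.univ)
    (x : G) (f : G → Ξ → ℝ) :
    ∀ᵐ ω ∂(Measure.infinitePi fun _ : ℕ => ν),
      Tendsto (fun T : ℕ => (∑ t ∈ Finset.range T, f (walk step x ω t) (ω t)) / T) atTop
        (𝓝 ((∑ y, ∫ ξ, f y ξ ∂ν) / Fintype.card G)) := by
  set m : ℝ := (∑ y, ∫ ξ, f y ξ ∂ν) / Fintype.card G with hm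
  have hcard : (Fintype.card G : ℝ) ≠ 0 := by
    exact_mod_cast Fintype.card_ne_zero
  have hsum : ∑ y, (∫ ξ, f y ξ ∂ν - m) = 0 := by
    rw [Finset.sum_sub_distrib, Finset.sum_const, Finset.card_univ, nsmul_eq_mul, hm,
      mul_div_cancel₀ _ hcard, sub_self]
  have hw1 : ∑ ξ, ν.real {ξ} = 1 := by simp
  obtain ⟨g, hg⟩ := exists_poisson hν hw1 hgen hsum
  have hi : ∀ ψ : Ξ → ℝ, Integrable ψ ν := fun ψ => Integrable.of_finite
  have hg' : ∀ y, ∫ ξ, g (y + step ξ) ∂ν = ∑ ξ, ν.real {ξ} * g (y + step ξ) := by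
    intro y
    rw [integral_fintype (hi _)]
    rfl
  -- The Poisson equation says exactly that `h` has mean zero at every position. Along the walk the
  -- `g` terms telescope, leaving a bounded boundary term.
  set h : G → Ξ → ℝ := fun y ξ => f y ξ - m - g y + g (y + step ξ) with hh
  have h0 : ∀ y, ∫ ξ, h y ξ ∂ν = 0 := by
    intro y
    simp only [hh]
    rw [integral_add (hi _) (hi _), integral_sub (hi _) (hi _), integral_sub (hi _) (hi _), hg',
      integral_const, integral_const]
    have := hg y
    simp only [probReal_univ, one_smul]
    linarith
  obtain ⟨C, hC⟩ : ∃ C : ℝ, ∀ y, |g y| ≤ C :=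
    ⟨∑ y, |g y|, fun y =>
      Finset.single_le_sum (f := fun y => |g y|) (fun _ _ => abs_nonneg _) (Finset.mem_univ y)⟩
  filter_upwards [ae_tendsto_walkSum_div step x h0] with ω hω
  have htel : ∀ T : ℕ, ∑ t ∈ Finset.range T, f (walk step x ω t) (ω t) =
      walkSum step x h T ω + (m * T + (g x - g (walk step x ω T))) := by
    intro T
    induction T with
    | zero => simp [walkSum, walk]
    | succ T ih =>
      have : walkSum step x h (T + 1) ω = walkSum step x h T ω + h (walk step x ω T) (ω T) := by
        simp [walkSum, Finset.sum_range_succ]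
      rw [Finset.sum_range_succ, ih, this, walk_succ]
      simp only [hh]
      push_cast
      ring
  have hbdd : Tendsto (fun T : ℕ => (g x - g (walk step x ω T)) / T) atTop (𝓝 0) := by
    refine squeeze_zero_norm (a := fun T : ℕ => (2 * C) / T) (fun T => ?_)
      (tendsto_const_div_atTop_nhds_zero_nat _)
    rw [Real.norm_eq_abs, abs_div, Nat.abs_cast]
    refine div_le_div_of_nonneg_right ?_ (by positivity)
    have h1 := abs_sub (g x) (g (walk step x ω T))
    linarith [hC x, hC (walk step x ω T)]
  have hlim := (hω.add hbdd).add_const m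
  rw [zero_add, zero_add] at hlim
  refine hlim.congr' ?_
  filter_upwards [eventually_gt_atTop 0] with T hT
  have hT' : (T : ℝ) ≠ 0 := by exact_mod_cast hT.ne'
  rw [htel]
  field_simp
  ring

end Ergodic

end

section

/-! ### Long-term frequencies in the network -/

variable {N : ℕ}

/-- The joint displacement of all nodes. -/
def jointStep (ξ : Node N → Noise N) (i : Node N) : ZMod (latticeSize N) := (ξ i).step

theorem pos_eq_walk (ω : Sample N) (t : ℕ) : pos ω t = walk jointStep ω.2.1 ω.2.2 t := by
  ext i
  simp [pos, walk, jointStep]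

theorem latticeSize_pos (hN : 0 < N) : 0 < latticeSize N := by
  unfold latticeSize
  exact Nat.sqrt_pos.2 (by omega)

theorem noiseMeasure_real_prod (p α : unitInterval) (s₁ : Set (Fin 3)) (s₂ s₃ : Set Bool)
    (s₄ : Set (Equiv.Perm (Node N))) (s₅ : Set Bool) (s₆ : Set (Equiv.Perm (Node N))) :
    (noiseMeasure p α N).real (s₁ ×ˢ s₂ ×ˢ s₃ ×ˢ s₄ ×ˢ s₅ ×ˢ s₆) =
      (uniformOn Set.univ).real s₁ * ((bernoulliMeasure true false p).real s₂ *
        ((bernoulliMeasure true false α).real s₃ * ((uniformOn Set.univ).real s₄ *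
          ((bernoulliMeasure true false p).real s₅ * (uniformOn Set.univ).real s₆)))) := by
  unfold noiseMeasure
  simp only [measureReal_prod_prod]

theorem bernoulli_real_true (p : unitInterval) :
    (bernoulliMeasure true false p).real {true} = p := by
  rw [bernoulliMeasure_real_apply_of_mem_of_notMem] <;> simp

theorem bernoulli_real_false (p : unitInterval) :
    (bernoulliMeasure true false p).real {false} = 1 - p := by
  rw [bernoulliMeasure_real_apply_of_notMem_of_mem] <;> simp

theorem uniformOn_real_singleton_pos {X : Type*} [Fintype X] [MeasurableSpace X]
    [MeasurableSingletonClass X] (x : X) : 0 < (uniformOn (Set.univ : Set X)).real {x} := by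
  rw [measureReal_def, ENNReal.toReal_pos_iff]
  refine ⟨pos_iff_ne_zero.2 ?_, measure_lt_top _ _⟩
  rw [Ne, uniformOn_eq_zero_iff Set.finite_univ]
  simp

theorem bernoulli_real_singleton_pos {p : unitInterval} (hp : 0 < p) (hp1 : p < 1) (x : Bool) :
    0 < (bernoulliMeasure true false p).real {x} := by
  cases x
  · rw [bernoulli_real_false]
    have : (p : ℝ) < 1 := hp1
    linarith
  · rw [bernoulli_real_true]
    exact hp

theorem noiseMeasure_real_singleton_pos {p α : unitInterval} (hp : 0 < p) (hp1 : p < 1)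
    (hα : 0 < α) (hα1 : α < 1) (x : Noise N) : 0 < (noiseMeasure p α N).real {x} := by
  obtain ⟨x₁, x₂, x₃, x₄, x₅, x₆⟩ := x
  simp only [← Set.singleton_prod_singleton]
  rw [noiseMeasure_real_prod]
  have h₁ := uniformOn_real_singleton_pos x₁
  have h₂ := bernoulli_real_singleton_pos hp hp1 x₂
  have h₃ := bernoulli_real_singleton_pos hα hα1 x₃
  have h₄ := uniformOn_real_singleton_pos x₄
  have h₅ := bernoulli_real_singleton_pos hp hp1 x₅
  have h₆ := uniformOn_real_singleton_pos x₆
  positivity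

theorem pi_noiseMeasure_real_singleton_pos {p α : unitInterval} (hp : 0 < p) (hp1 : p < 1)
    (hα : 0 < α) (hα1 : α < 1) (ξ : Node N → Noise N) :
    0 < (Measure.pi fun _ : Node N => noiseMeasure p α N).real {ξ} := by
  rw [← Set.univ_pi_singleton, measureReal_def, Measure.pi_pi, ENNReal.toReal_prod]
  exact Finset.prod_pos fun i _ => noiseMeasure_real_singleton_pos hp hp1 hα hα1 _

/-- The motion of the nodes is irreducible. -/
theorem eq_univ_of_add_jointStep_mem (hN : 0 < N) {A : Set (Node N → ZMod (latticeSize N))}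
    (hA : A.Nonempty) (h : ∀ x ∈ A, ∀ ξ : Node N → Noise N, x + jointStep ξ ∈ A) :
    A = Set.univ := by
  classical
  have : NeZero (latticeSize N) := ⟨(latticeSize_pos hN).ne'⟩
  have h1 : ∀ i : Node N, ∀ x ∈ A, x + Pi.single i 1 ∈ A := by
    intro i x hx
    -- Node `i` steps by `+1` and the others stay (`1` encodes the zero step); the coins and
    -- rankings are arbitrary. Forward steps suffice on a cycle.
    let ξ : Node N → Noise N := fun k => (if k = i then 2 else 1, true, true, 1, true, 1)
    have hξ : jointStep ξ = Pi.single i 1 := by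
      ext k
      by_cases hk : k = i
      · subst hk
        simp [jointStep, Noise.step, ξ]
        norm_num
      · simp [jointStep, Noise.step, ξ, hk]
    rw [← hξ]
    exact h x hx ξ
  have h2 : ∀ (i : Node N) (d : ℕ), ∀ x ∈ A, x + Pi.single i (d : ZMod (latticeSize N)) ∈ A := by
    intro i d
    induction d with
    | zero => intro x hx; simpa using hx
    | succ d ih =>
      intro x hx
      have := h1 i _ (ih x hx)
      rwa [add_assoc, ← Pi.single_add, ← Nat.cast_succ] at this
  have h3 : ∀ (y : Node N → ZMod (latticeSize N)) (S : Finset (Node N)), ∀ x ∈ A,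
      x + ∑ i ∈ S, Pi.single i (y i) ∈ A := by
    intro y S
    induction S using Finset.induction_on with
    | empty => intro x hx; simpa using hx
    | insert i S hi ih =>
      intro x hx
      rw [Finset.sum_insert hi, ← add_assoc]
      refine ih _ ?_
      have := h2 i (y i).val x hx
      rwa [ZMod.natCast_zmod_val] at this
  obtain ⟨x, hx⟩ := hA
  refine Set.eq_univ_of_forall fun y => ?_
  have := h3 (y - x) Finset.univ x hx
  rw [Finset.univ_sum_single] at this
  simpa using this

/-- There are finitely many starting positions, so one null set of noises serves all of them, and
the product structure lifts it to the whole sample space. -/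
theorem ae_law_of_forall_ae {p α : unitInterval} (hN : 0 < N)
    {Q : (Node N → ZMod (latticeSize N)) → (ℕ → Node N → Noise N) → Prop}
    (h : ∀ x, ∀ᵐ ξ ∂(Measure.infinitePi fun _ : ℕ => Measure.pi fun _ => noiseMeasure p α N),
      Q x ξ) : ∀ᵐ ω ∂(law p α N), Q ω.2.1 ω.2.2 := by
  have : NeZero (latticeSize N) := ⟨(latticeSize_pos hN).ne'⟩
  have h1 := ae_all_iff.2 h
  have h2 := Measure.quasiMeasurePreserving_snd.ae (Measure.quasiMeasurePreserving_snd.ae h1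
    (μa := (Measure.pi fun _ : Node N => uniformOn (Set.univ : Set (ZMod (latticeSize N)))).prod
      (Measure.infinitePi fun _ : ℕ => Measure.pi fun _ => noiseMeasure p α N)))
    (μa := law p α N)
  filter_upwards [h2] with ω hω
  exact hω _

open Classical in
/-- The long-term frequency of the time-slots in which the positions are in `U` and the coins
in `V`. -/
theorem ae_tendsto_frequency {p α : unitInterval} (hp : 0 < p) (hp1 : p < 1)
    (hα : 0 < α) (hα1 : α < 1) (hN : 0 < N) [NeZero (latticeSize N)]
    (U : Finset (Node N → ZMod (latticeSize N))) (V : Set (Node N → Noise N)) :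
    ∀ᵐ ω ∂(law p α N), Tendsto (fun t : ℕ =>
      ((∑ τ ∈ Finset.range t, if pos ω τ ∈ U ∧ ω.2.2 τ ∈ V then 1 else 0 : ℕ) : ℝ) / t) atTop
        (𝓝 (U.card / (latticeSize N : ℝ) ^ (2 * N) *
          (Measure.pi fun _ : Node N => noiseMeasure p α N).real V)) := by
  have hmain := fun x => ae_tendsto_walk_average
    (pi_noiseMeasure_real_singleton_pos (N := N) hp hp1 hα hα1) jointStep
    (fun A hA h => eq_univ_of_add_jointStep_mem hN hA h) x
    (fun y ξ => if y ∈ U ∧ ξ ∈ V then (1 : ℝ) else 0)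
  have := ae_law_of_forall_ae hN hmain
  filter_upwards [this] with ω hω
  convert hω using 2
  · rename_i t
    push_cast
    simp only [pos_eq_walk]
  · have h1 : ∀ y, ∫ ξ, (if y ∈ U ∧ ξ ∈ V then (1 : ℝ) else 0)
        ∂(Measure.pi fun _ : Node N => noiseMeasure p α N) =
        if y ∈ U then (Measure.pi fun _ : Node N => noiseMeasure p α N).real V else 0 := by
      intro y
      by_cases hy : y ∈ U
      · simp only [hy, true_and, if_true]
        rw [← integral_indicator_one (Set.Finite.measurableSet V.toFinite)]
        rfl
      · simp [hy]
    simp only [h1]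
    rw [Finset.sum_ite_mem, Finset.univ_inter, Finset.sum_const, nsmul_eq_mul]
    simp [ZMod.card]
    ring

/-! ### Stationary probability of isolated positions and of favorable coins -/

/-- Positions in which `i` is at `u`, `j` is at `v` and no other node `k` is in `K k`. -/
def isolatedPositions [NeZero (latticeSize N)] (i j : Node N) (u v : ZMod (latticeSize N))
    (K : Node N → Finset (ZMod (latticeSize N))) : Finset (Node N → ZMod (latticeSize N)) :=
  Fintype.piFinset fun k => if k = i then {u} else if k = j then {v} else (K k)ᶜ

theorem mem_isolatedPositions [NeZero (latticeSize N)] {i j : Node N} (hij : i ≠ j)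
    {u v : ZMod (latticeSize N)} {K : Node N → Finset (ZMod (latticeSize N))}
    {x : Node N → ZMod (latticeSize N)} : x ∈ isolatedPositions i j u v K ↔
      x i = u ∧ x j = v ∧ ∀ k, k ≠ i → k ≠ j → x k ∉ K k := by
  simp only [isolatedPositions, Fintype.mem_piFinset]
  constructor
  · intro h
    refine ⟨by simpa using h i, by simpa [hij.symm] using h j, fun k hki hkj => ?_⟩
    simpa [hki, hkj] using h k
  · rintro ⟨h1, h2, h3⟩ k
    by_cases hki : k = i
    · subst hki; simpa using h1
    · by_cases hkj : k = j
      · subst hkj; simpa [hki] using h2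
      · simpa [hki, hkj] using h3 k hki hkj

/-- The stationary probability is a product over nodes: `1/m` for each of `i` and `j`, at least `1 -
q/m` for a node with a forbidden point, and `1` for the rest. Hence only the number `β` of
constrained nodes enters the exponent. -/
theorem le_card_isolatedPositions [NeZero (latticeSize N)] {i j : Node N} (hij : i ≠ j)
    (u v : ZMod (latticeSize N)) {K : Node N → Finset (ZMod (latticeSize N))} {q β : ℕ}
    (hq : ∀ k, (K k).card ≤ q) (hqm : q ≤ latticeSize N)
    (hβ : (Finset.univ.filter fun k => (K k).Nonempty).card ≤ β) :
    (1 - q / latticeSize N : ℝ) ^ β / (latticeSize N : ℝ) ^ 2 ≤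
      (isolatedPositions i j u v K).card / (latticeSize N : ℝ) ^ (2 * N) := by
  classical
  have hm : (0 : ℝ) < latticeSize N := by
    exact_mod_cast Nat.pos_of_ne_zero (NeZero.ne (latticeSize N))
  set m : ℝ := ((latticeSize N : ℕ) : ℝ) with hmdef
  set r : ℝ := 1 - q / m with hr
  have hr0 : 0 ≤ r := by
    rw [hr, sub_nonneg, div_le_one hm]
    rw [hmdef]
    exact_mod_cast hqm
  have hr1 : r ≤ 1 := by
    rw [hr]
    have : 0 ≤ q / m := by positivity
    linarith
  set U : Node N → Finset (ZMod (latticeSize N)) :=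
    fun k => if k = i then {u} else if k = j then {v} else (K k)ᶜ with hU
  have hcard : ((isolatedPositions i j u v K).card : ℝ) / m ^ (2 * N) =
      ∏ k, ((U k).card / m : ℝ) := by
    rw [isolatedPositions, Fintype.card_piFinset, Finset.prod_div_distrib]
    simp [hU]
  rw [hcard]
  -- A factor `r ≤ 1` is charged to `i` and `j` as well when their sets are nonempty; this only
  -- lowers the product and makes the exponent a plain count.
  set g : Node N → ℝ := fun k =>
    (if k = i then m⁻¹ else 1) * ((if k = j then m⁻¹ else 1) *
      if (K k).Nonempty then r else 1) with hg
  have hprod : ∏ k, g k = m⁻¹ * (m⁻¹ *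
      r ^ (Finset.univ.filter fun k => (K k).Nonempty).card) := by
    simp only [hg, Finset.prod_mul_distrib]
    rw [Finset.prod_ite_eq' Finset.univ i, Finset.prod_ite_eq' Finset.univ j]
    simp [Finset.prod_ite]
  have hle : ∏ k, g k ≤ ∏ k, ((U k).card / m : ℝ) := by
    have hm0 : 0 ≤ m⁻¹ := by positivity
    refine Finset.prod_le_prod (fun k _ => ?_) fun k _ => ?_
    · simp only [hg]
      refine mul_nonneg ?_ (mul_nonneg ?_ ?_) <;> split_ifs <;> first | assumption | norm_num
    · have hite : (if (K k).Nonempty then r else 1) ≤ 1 := by split_ifs <;> linarith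
      by_cases hki : k = i
      · have hkj : k ≠ j := fun h => hij (hki.symm.trans h)
        simp only [hg, hU, if_pos hki, if_neg hkj, one_mul, Finset.card_singleton, Nat.cast_one,
          one_div]
        exact mul_le_of_le_one_right hm0 hite
      · by_cases hkj : k = j
        · simp only [hg, hU, if_neg hki, if_pos hkj, one_mul, Finset.card_singleton,
            Nat.cast_one, one_div]
          exact mul_le_of_le_one_right hm0 hite
        · simp only [hg, hU, if_neg hki, if_neg hkj, one_mul]
          rw [Finset.card_compl, ZMod.card, Nat.cast_sub ((hq k).trans hqm), ← hmdef, sub_div,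
            div_self hm.ne']
          split_ifs with hne
          · rw [hr]
            have : ((K k).card : ℝ) ≤ q := by exact_mod_cast hq k
            gcongr
          · rw [Finset.not_nonempty_iff_eq_empty.1 hne]
            simp
  refine le_trans ?_ hle
  rw [hprod]
  have hpow := pow_le_pow_of_le_one hr0 hr1 hβ
  have : r ^ β / m ^ 2 = m⁻¹ * (m⁻¹ * r ^ β) := by
    field_simp
  rw [this]
  gcongr

theorem pi_real_pair {X : Type} [MeasurableSpace X] (μ : Measure X) [IsProbabilityMeasure μ]
    {i j : Node N} (hij : i ≠ j) (S T : Set X) :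
    (Measure.pi fun _ : Node N => μ).real {ξ | ξ i ∈ S ∧ ξ j ∈ T} = μ.real S * μ.real T := by
  have hset : {ξ : Node N → X | ξ i ∈ S ∧ ξ j ∈ T} =
      Set.univ.pi fun k => if k = i then S else if k = j then T else Set.univ := by
    ext ξ
    simp only [Set.mem_ofPred_eq, Set.mem_univ_pi]
    constructor
    · rintro ⟨h1, h2⟩ k
      by_cases hki : k = i
      · subst hki; simpa using h1
      · by_cases hkj : k = j
        · subst hkj; simpa [hki] using h2
        · simp [hki, hkj]
    · intro h
      exact ⟨by simpa using h i, by simpa [hij.symm] using h j⟩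
  rw [hset, measureReal_def, Measure.pi_pi, ENNReal.toReal_prod, Fintype.prod_eq_mul i j hij]
  · simp [hij.symm, measureReal_def]
  · rintro k ⟨hki, hkj⟩
    simp [hki, hkj]

/-- The coins for a transmission from `i` to a silent `j` in sub-slot A. -/
def coinsA (i j : Node N) : Set (Node N → Noise N) :=
  {ξ | ((ξ i).actA = true ∧ (ξ i).sendA = true) ∧ (ξ j).actA = false}

/-- The coins for a transmission from `i` to a silent `j` in sub-slot B. -/
def coinsB (i j : Node N) : Set (Node N → Noise N) :=
  {ξ | (ξ i).actB = true ∧ (ξ j).actB = false}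

theorem pi_noiseMeasure_real_coinsA (p α : unitInterval) {i j : Node N} (hij : i ≠ j) :
    (Measure.pi fun _ : Node N => noiseMeasure p α N).real (coinsA i j) =
      p * α * (1 - p) := by
  have h := pi_real_pair (noiseMeasure p α N) hij
    (Set.univ ×ˢ {true} ×ˢ {true} ×ˢ Set.univ ×ˢ Set.univ ×ˢ Set.univ)
    (Set.univ ×ˢ {false} ×ˢ Set.univ ×ˢ Set.univ ×ˢ Set.univ ×ˢ Set.univ)
  rw [noiseMeasure_real_prod, noiseMeasure_real_prod, bernoulli_real_true, bernoulli_real_true,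
    bernoulli_real_false] at h
  simp only [probReal_univ, one_mul, mul_one] at h
  rw [← h]
  congr 1
  ext ξ
  simp [coinsA, Noise.actA, Noise.sendA]

theorem pi_noiseMeasure_real_coinsB (p α : unitInterval) {i j : Node N} (hij : i ≠ j) :
    (Measure.pi fun _ : Node N => noiseMeasure p α N).real (coinsB i j) = p * (1 - p) := by
  have h := pi_real_pair (noiseMeasure p α N) hij
    (Set.univ ×ˢ Set.univ ×ˢ Set.univ ×ˢ Set.univ ×ˢ {true} ×ˢ Set.univ)
    (Set.univ ×ˢ Set.univ ×ˢ Set.univ ×ˢ Set.univ ×ˢ {false} ×ˢ Set.univ)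
  rw [noiseMeasure_real_prod, noiseMeasure_real_prod, bernoulli_real_true,
    bernoulli_real_false] at h
  simp only [probReal_univ, one_mul, mul_one] at h
  rw [← h]
  congr 1
  ext ξ
  simp [coinsB, Noise.actB]

end

section

/-! ### Great circles and lattice points -/

open InnerProductGeometry

theorem inner_E3 (u v : E3) : inner ℝ u v = u 0 * v 0 + u 1 * v 1 + u 2 * v 2 := by
  simp [PiLp.inner_apply, Fin.sum_univ_three]
  ring

theorem cross_apply_zero (u v : E3) : cross u v 0 = u 1 * v 2 - u 2 * v 1 := by
  simp [cross, crossProduct]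

theorem cross_apply_one (u v : E3) : cross u v 1 = u 2 * v 0 - u 0 * v 2 := by
  simp [cross, crossProduct]

theorem cross_apply_two (u v : E3) : cross u v 2 = u 0 * v 1 - u 1 * v 0 := by
  simp [cross, crossProduct]

theorem inner_left_cross (u v : E3) : inner ℝ u (cross u v) = 0 := by
  rw [inner_E3, cross_apply_zero, cross_apply_one, cross_apply_two]; ring

theorem inner_right_cross (u v : E3) : inner ℝ v (cross u v) = 0 := by
  rw [inner_E3, cross_apply_zero, cross_apply_one, cross_apply_two]; ring

theorem inner_cross_cross (u v : E3) :
    inner ℝ (cross u v) (cross u v) = inner ℝ u u * inner ℝ v v - inner ℝ u v ^ 2 := by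
  simp only [inner_E3, cross_apply_zero, cross_apply_one, cross_apply_two]; ring

/-- Gram's determinant. -/
theorem inner_cross_sq (x y z : E3) : inner ℝ (cross x y) z ^ 2 =
    inner ℝ x x * (inner ℝ y y * inner ℝ z z - inner ℝ y z ^ 2) -
      inner ℝ x y * (inner ℝ x y * inner ℝ z z - inner ℝ y z * inner ℝ x z) +
        inner ℝ x z * (inner ℝ x y * inner ℝ y z - inner ℝ y y * inner ℝ x z) := by
  simp only [inner_E3, cross_apply_zero, cross_apply_one, cross_apply_two]; ring

theorem inner_self_eq_one {u : E3} (h : ‖u‖ = 1) : inner ℝ u u = (1 : ℝ) := by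
  rw [real_inner_self_eq_norm_sq, h, one_pow]

theorem norm_eq_one_of_inner {u : E3} (h : inner ℝ u u = (1 : ℝ)) : ‖u‖ = 1 := by
  rw [real_inner_self_eq_norm_sq] at h
  exact (pow_eq_one_iff_of_nonneg (norm_nonneg u) two_ne_zero).1 h

theorem S2.norm_eq (x : S2) : ‖(x : E3)‖ = 1 := by simp

theorem S2.inner_self (x : S2) : inner ℝ (x : E3) x = (1 : ℝ) := inner_self_eq_one (S2.norm_eq x)

theorem angle_eq_arccos {u v : E3} (hu : ‖u‖ = 1) (hv : ‖v‖ = 1) :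
    angle u v = Real.arccos (inner ℝ u v) := by
  rw [angle, hu, hv, mul_one, div_one]

/-- The inner products of a unit vector on a great circle with a frame of the circle. -/
theorem exists_angle_of_mem_greatCircle {x : S2} {y z : E3} (hy : y ∈ greatCircle x)
    (hz : z ∈ greatCircle x) :
    ∃ φ : ℝ, inner ℝ y z = Real.cos φ ∧ inner ℝ (cross x y) z = Real.sin φ := by
  have h := inner_cross_sq x y z
  rw [S2.inner_self, inner_self_eq_one hy.1, inner_self_eq_one hz.1, hy.2, hz.2] at h
  set c : ℝ := inner ℝ y z
  set s : ℝ := inner ℝ (cross x y) z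
  -- With `y` and `z` unit vectors orthogonal to the unit vector `x`, the Gram identity collapses to
  -- `s² = 1 - c²`; the angle is then a complex argument.
  have hcs : c ^ 2 + s ^ 2 = 1 := by rw [h]; ring
  have hn : ‖(⟨c, s⟩ : ℂ)‖ = 1 := by
    rw [Complex.norm_def, Complex.normSq_mk, Real.sqrt_eq_one]
    nlinarith
  refine ⟨Complex.arg ⟨c, s⟩, ?_, ?_⟩
  · rw [Complex.cos_arg (by rw [← norm_ne_zero_iff, hn]; exact one_ne_zero), hn, div_one]
  · rw [Complex.sin_arg, hn, div_one]

theorem arccos_cos_eq_abs {δ : ℝ} (h : |δ| ≤ Real.pi) : Real.arccos (Real.cos δ) = |δ| := by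
  rw [← Real.cos_abs, Real.arccos_cos (abs_nonneg _) h]

section Lattice

variable {N : ℕ} (P : Placement N) (s : Config N) (i : Node N)

/-- The angle at which lattice point number `l` is placed. -/
def latticeAngle (l : ZMod (latticeSize N)) : ℝ :=
  2 * Real.pi * (l.val : ℝ) / (latticeSize N : ℝ)

theorem latticePoint_eq (l : ZMod (latticeSize N)) : latticePoint P s i l =
    Real.cos (latticeAngle l) • (P.start s i : E3) +
      Real.sin (latticeAngle l) • cross (s.pole i) (P.start s i) := rfl

theorem inner_cross_start_self : inner ℝ (cross (s.pole i) (P.start s i))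
    (cross (s.pole i) (P.start s i)) = (1 : ℝ) := by
  rw [inner_cross_cross, S2.inner_self, S2.inner_self, (P.start_mem s i).2]
  norm_num

theorem inner_latticePoint_latticePoint (l l' : ZMod (latticeSize N)) :
    inner ℝ (latticePoint P s i l) (latticePoint P s i l') =
      Real.cos (latticeAngle l - latticeAngle l') := by
  have h1 : inner ℝ (cross (s.pole i) (P.start s i)) (P.start s i : E3) = (0 : ℝ) := by
    rw [real_inner_comm, inner_right_cross]
  rw [latticePoint_eq, latticePoint_eq, Real.cos_sub]
  simp only [inner_add_left, inner_add_right, real_inner_smul_left, real_inner_smul_right, h1,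
    inner_right_cross, S2.inner_self, inner_cross_start_self]
  ring

theorem latticePoint_mem (l : ZMod (latticeSize N)) :
    latticePoint P s i l ∈ greatCircle (s.pole i) := by
  constructor
  · refine norm_eq_one_of_inner ?_
    rw [inner_latticePoint_latticePoint, sub_self, Real.cos_zero]
  · rw [latticePoint_eq, inner_add_right, real_inner_smul_right, real_inner_smul_right,
      (P.start_mem s i).2, inner_left_cross]
    ring

/-- Every point of a great circle is close to a lattice point. -/
theorem exists_angle_latticePoint_le (hN : 0 < N) {z : E3} (hz : z ∈ greatCircle (s.pole i)) :
    ∃ l, angle (latticePoint P s i l) z ≤ Real.pi / latticeSize N := by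
  have hm : 0 < latticeSize N := latticeSize_pos hN
  have hmR : (0 : ℝ) < latticeSize N := by exact_mod_cast hm
  have hm1 : (1 : ℝ) ≤ latticeSize N := by exact_mod_cast hm
  have : NeZero (latticeSize N) := ⟨hm.ne'⟩
  obtain ⟨φ, hc, hs⟩ := exists_angle_of_mem_greatCircle (P.start_mem s i) hz
  -- The spacing is `2π/m`, so rounding the angle in these units leaves an error of at most `π/m`.
  -- Reducing `r` modulo `m` changes the angle by a multiple of `2π`.
  set r : ℤ := round (φ * latticeSize N / (2 * Real.pi)) with hr
  refine ⟨(r : ZMod (latticeSize N)), ?_⟩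
  have hval : (((r : ZMod (latticeSize N)).val : ℤ) : ℝ) =
      r - latticeSize N * ((r / latticeSize N : ℤ) : ℝ) := by
    rw [ZMod.val_intCast, Int.emod_def]
    push_cast
    ring
  have hangle : latticeAngle (r : ZMod (latticeSize N)) - φ =
      (2 * Real.pi * r / latticeSize N - φ) - ((r / latticeSize N : ℤ) : ℝ) * (2 * Real.pi) := by
    rw [Int.cast_natCast] at hval
    rw [latticeAngle, hval]
    field_simp
    ring
  rw [angle_eq_arccos (latticePoint_mem P s i _).1 hz.1, latticePoint_eq, inner_add_left,
    real_inner_smul_left, real_inner_smul_left, hc, hs, ← Real.cos_sub, hangle,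
    Real.cos_sub_int_mul_two_pi]
  have hround := abs_sub_round (φ * latticeSize N / (2 * Real.pi))
  rw [← hr, abs_sub_comm] at hround
  have hδ : |2 * Real.pi * r / latticeSize N - φ| ≤ Real.pi / latticeSize N := by
    have : 2 * Real.pi * r / latticeSize N - φ =
        (2 * Real.pi / latticeSize N) * (r - φ * latticeSize N / (2 * Real.pi)) := by
      field_simp
    rw [this, abs_mul, abs_of_pos (by positivity)]
    calc 2 * Real.pi / latticeSize N * |r - φ * latticeSize N / (2 * Real.pi)|
        ≤ 2 * Real.pi / latticeSize N * (1 / 2) := by gcongr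
      _ = Real.pi / latticeSize N := by ring
  rwa [arccos_cos_eq_abs (hδ.trans (div_le_self Real.pi_pos.le hm1))]

/-- Lattice points at a small distance have close numbers. -/
theorem abs_sub_le_or_of_angle_le (hN : 0 < N) {q : ℕ} {l l' : ZMod (latticeSize N)}
    (h : angle (latticePoint P s i l) (latticePoint P s i l') <
      2 * Real.pi * (q + 1 : ℕ) / latticeSize N) :
    |(l.val : ℤ) - l'.val| ≤ q ∨ (latticeSize N : ℤ) - q ≤ |(l.val : ℤ) - l'.val| := by
  have hm : 0 < latticeSize N := latticeSize_pos hN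
  have hmR : (0 : ℝ) < latticeSize N := by exact_mod_cast hm
  have : NeZero (latticeSize N) := ⟨hm.ne'⟩
  have hl := ZMod.val_lt l
  have hl' := ZMod.val_lt l'
  rw [angle_eq_arccos (latticePoint_mem P s i _).1 (latticePoint_mem P s i _).1,
    inner_latticePoint_latticePoint] at h
  set d : ℤ := |(l.val : ℤ) - l'.val| with hd
  have hdm : d < latticeSize N := by
    rw [hd, abs_lt]
    omega
  have hcos : Real.cos (latticeAngle l - latticeAngle l') =
      Real.cos (2 * Real.pi * d / latticeSize N) := by
    rw [← Real.cos_abs (latticeAngle l - latticeAngle l')]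
    congr 1
    have : latticeAngle l - latticeAngle l' =
        2 * Real.pi / latticeSize N * (((l.val : ℤ) - l'.val : ℤ) : ℝ) := by
      unfold latticeAngle
      push_cast
      ring
    rw [this, abs_mul, abs_of_pos (by positivity), hd, Int.cast_abs]
    ring
  have hd0 : 0 ≤ d := abs_nonneg _
  have hd0R : (0 : ℝ) ≤ d := by exact_mod_cast hd0
  have key : ∀ e : ℤ, 2 * Real.pi * e / latticeSize N <
      2 * Real.pi * (q + 1 : ℕ) / latticeSize N → e ≤ q := by
    intro e he
    rw [div_lt_div_iff_of_pos_right hmR, mul_lt_mul_iff_right₀ (by positivity)] at he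
    have : e < ((q + 1 : ℕ) : ℤ) := by exact_mod_cast he
    push_cast at this
    omega
  rw [hcos] at h
  -- The angle between the points is the shorter of the two arcs, `d` or `m - d` lattice steps.
  by_cases hcase : 2 * Real.pi * d / latticeSize N ≤ Real.pi
  · left
    rw [Real.arccos_cos (by positivity) hcase] at h
    exact key d h
  · right
    push Not at hcase
    have hdmR : (d : ℝ) < latticeSize N := by exact_mod_cast hdm
    have h2 : Real.cos (2 * Real.pi * d / latticeSize N) =
        Real.cos (2 * Real.pi * ((latticeSize N - d : ℤ) : ℝ) / latticeSize N) := by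
      rw [← Real.cos_two_pi_sub]
      congr 1
      push_cast
      field_simp
    have h3 : 2 * Real.pi * ((latticeSize N - d : ℤ) : ℝ) / latticeSize N =
        2 * Real.pi - 2 * Real.pi * d / latticeSize N := by
      push_cast
      field_simp
    rw [h2, Real.arccos_cos] at h
    · have := key _ h
      omega
    · rw [h3, sub_nonneg, div_le_iff₀ hmR]
      gcongr
    · rw [h3]; linarith

/-- Few lattice points lie in a small disk. -/
theorem card_le_of_angle_le [NeZero (latticeSize N)] (hN : 0 < N) {q : ℕ} {z : E3} {ρ : ℝ}
    (hρ : 2 * ρ < 2 * Real.pi * (q + 1 : ℕ) / latticeSize N)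
    {K : Finset (ZMod (latticeSize N))} (hK : ∀ l ∈ K, angle (latticePoint P s i l) z ≤ ρ) :
    K.card ≤ 4 * q + 3 := by
  classical
  rcases K.eq_empty_or_nonempty with rfl | ⟨l', hl'⟩
  · simp
  set m : ℤ := (latticeSize N : ℤ) with hm
  set v : ℤ := (l'.val : ℤ) with hv
  -- Representatives within cyclic distance `q` of `v`: one window around `v` and one for each
  -- direction of wrapping, of sizes `2q + 1`, `q + 1` and `q + 1`.
  set I : Finset ℤ := Finset.Icc (v - q) (v + q) ∪
    (Finset.Icc (v + m - q) (v + m) ∪ Finset.Icc (v - m) (v - m + q)) with hI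
  have hmaps : ∀ l ∈ K, (l.val : ℤ) ∈ I := by
    intro l hl
    have h1 : angle (latticePoint P s i l) (latticePoint P s i l') ≤ 2 * ρ := by
      have h2 := angle_le_angle_add_angle (latticePoint P s i l) z (latticePoint P s i l')
      have h3 := hK l hl
      have h4 := hK l' hl'
      rw [angle_comm] at h4
      linarith
    have hlm : (l.val : ℤ) < m := by
      have := ZMod.val_lt l
      omega
    have hlm' : v < m := by
      have := ZMod.val_lt l'
      omega
    simp only [hI, Finset.mem_union, Finset.mem_Icc]
    rcases abs_sub_le_or_of_angle_le P s i hN (h1.trans_lt hρ) with h5 | h5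
    · have := abs_le.1 h5
      omega
    · rcases le_abs.1 h5 with h6 | h6 <;> omega
  have hinj : Set.InjOn (fun l : ZMod (latticeSize N) => (l.val : ℤ)) K := by
    intro a _ b _ hab
    exact ZMod.val_injective _ (Nat.cast_injective (R := ℤ) hab)
  have hcard := Finset.card_le_card_of_injOn _ hmaps hinj
  have hI1 : I.card ≤ 4 * q + 3 := by
    refine (Finset.card_union_le _ _).trans ?_
    have := Finset.card_union_le (Finset.Icc (v + m - q) (v + m)) (Finset.Icc (v - m) (v - m + q))
    simp only [Int.card_Icc] at this ⊢
    omega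
  exact hcard.trans hI1

end Lattice

/-! ### Intersection points of great circles -/

section Meet

variable {N : ℕ}

/-- For parallel poles `crossing` takes the default value `0`, so being nonzero expresses that the
two circles are distinct. -/
theorem norm_crossing {x y : S2} (h : crossing x y ≠ 0) : ‖crossing x y‖ = 1 := by
  have hc : cross x y ≠ 0 := by
    intro h0
    exact h (by rw [crossing, h0, smul_zero])
  rw [crossing, norm_smul, norm_inv, norm_norm, inv_mul_cancel₀ (norm_ne_zero_iff.2 hc)]

theorem inner_left_crossing (x y : S2) : inner ℝ (x : E3) (crossing x y) = (0 : ℝ) := by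
  rw [crossing, real_inner_smul_right, inner_left_cross, mul_zero]

theorem inner_right_crossing (x y : S2) : inner ℝ (y : E3) (crossing x y) = (0 : ℝ) := by
  rw [crossing, real_inner_smul_right, inner_right_cross, mul_zero]

theorem Config.meet_comm (s : Config N) (i j : Node N) : s.meet i j = s.meet j i := by
  rcases lt_trichotomy i j with h | h | h
  · rw [meet, meet, if_pos h, if_neg h.not_gt]
  · rw [h]
  · rw [meet, meet, if_neg h.not_gt, if_pos h]

theorem Config.meetLt_mem {s : Config N} {i j : Node N} (h : s.meetLt i j ≠ 0) :
    s.meetLt i j ∈ greatCircle (s.pole i) ∧ s.meetLt i j ∈ greatCircle (s.pole j) := by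
  unfold meetLt at h ⊢
  split_ifs at h ⊢
  · exact ⟨⟨norm_crossing h, inner_left_crossing _ _⟩, norm_crossing h, inner_right_crossing _ _⟩
  · rw [neg_ne_zero] at h
    refine ⟨⟨?_, ?_⟩, ?_, ?_⟩
    · rw [norm_neg, norm_crossing h]
    · rw [inner_neg_right, inner_left_crossing, neg_zero]
    · rw [norm_neg, norm_crossing h]
    · rw [inner_neg_right, inner_right_crossing, neg_zero]

theorem Config.meet_mem {s : Config N} {i j : Node N} (h : s.meet i j ≠ 0) :
    s.meet i j ∈ greatCircle (s.pole i) ∧ s.meet i j ∈ greatCircle (s.pole j) := by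
  unfold meet at h ⊢
  split_ifs at h ⊢
  · exact meetLt_mem h
  · exact (meetLt_mem h).symm

end Meet

end

section

open InnerProductGeometry

variable {N : ℕ}

/-! ### Isolated pairs of neighbors -/

/-- The radius of the disks around the intersection points. -/
def diskRadius (Δ : ℝ) (N : ℕ) : ℝ := (2 + Δ) * √(Real.pi / ((2 * N : ℕ) : ℝ))

/-- The angle at which the radius of the disks is seen from the center of the sphere. -/
def diskAngle (Δ : ℝ) (N : ℕ) : ℝ := 2 * Real.pi * (2 + Δ) / √((2 * N : ℕ) : ℝ)

/-- The unit-area sphere has radius `1 / (2√π)`; this converts the disks to angles, in which the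
geometric estimates are made. -/
theorem gdist_le_diskRadius_iff (Δ : ℝ) (u z : E3) :
    gdist u z ≤ diskRadius Δ N ↔ angle u z ≤ diskAngle Δ N := by
  have hpi : 0 < √Real.pi := Real.sqrt_pos.2 Real.pi_pos
  have h : diskRadius Δ N * (2 * √Real.pi) = diskAngle Δ N := by
    rw [diskRadius, diskAngle, Real.sqrt_div Real.pi_pos.le]
    have := Real.mul_self_sqrt Real.pi_pos.le
    calc (2 + Δ) * (√Real.pi / √((2 * N : ℕ) : ℝ)) * (2 * √Real.pi)
        = 2 * (√Real.pi * √Real.pi) * (2 + Δ) / √((2 * N : ℕ) : ℝ) := by ring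
      _ = _ := by rw [this]
  rw [gdist, div_le_iff₀ (by positivity), h]

theorem mem_disk_iff {Δ : ℝ} {u z : E3} :
    u ∈ disk z (diskRadius Δ N) ↔ ‖u‖ = 1 ∧ angle u z ≤ diskAngle Δ N := by
  rw [← gdist_le_diskRadius_iff]
  rfl

theorem gdist_le_gdist_iff {u v u' v' : E3} :
    gdist u v ≤ gdist u' v' ↔ angle u v ≤ angle u' v' := by
  have hpi : 0 < √Real.pi := Real.sqrt_pos.2 Real.pi_pos
  rw [gdist, gdist, div_le_div_iff_of_pos_right (by positivity)]

theorem latticeSize_le_sqrt : (latticeSize N : ℝ) ≤ √((2 * N : ℕ) : ℝ) :=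
  Real.nat_sqrt_le_real_sqrt

theorem sqrt_le_latticeSize_add_one : √((2 * N : ℕ) : ℝ) ≤ latticeSize N + 1 :=
  Real.real_sqrt_lt_nat_sqrt_succ.le

theorem diskAngle_le {Δ : ℝ} (hΔ : 0 < Δ) (hN : 0 < N) :
    diskAngle Δ N ≤ 2 * Real.pi * (2 + Δ) / latticeSize N := by
  have hm : (0 : ℝ) < latticeSize N := by exact_mod_cast latticeSize_pos hN
  have := latticeSize_le_sqrt (N := N)
  unfold diskAngle
  gcongr

/-- The disk has angular radius `2(2 + Δ)π/√n`; replacing `√n` by `m + 1` costs at most one unit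
`π/m` when `m ≥ 3 + 2Δ`. The value `3 + 2Δ = 2(1 + Δ) + 1` is what the interference estimate
consumes. -/
theorem le_diskAngle {Δ : ℝ} (hΔ : 0 < Δ) (hN : 0 < N) (hm : 3 + 2 * Δ ≤ latticeSize N) :
    (3 + 2 * Δ) * (Real.pi / latticeSize N) ≤ diskAngle Δ N := by
  have hm0 : (0 : ℝ) < latticeSize N := by exact_mod_cast latticeSize_pos hN
  have h1 := latticeSize_le_sqrt (N := N)
  have h2 := sqrt_le_latticeSize_add_one (N := N)
  have hs : 0 < √((2 * N : ℕ) : ℝ) := hm0.trans_le h1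
  rw [diskAngle, ← mul_div_assoc, div_le_div_iff₀ hm0 hs]
  have h3 : (3 + 2 * Δ) * √((2 * N : ℕ) : ℝ) ≤ 2 * (2 + Δ) * latticeSize N := by
    nlinarith [mul_le_mul_of_nonneg_left h2 (show (0 : ℝ) ≤ 3 + 2 * Δ by linarith)]
  nlinarith [mul_le_mul_of_nonneg_left h3 Real.pi_pos.le]

/-- In a typical configuration of a large network, no two great circles coincide. -/
theorem Config.Typical.meet_ne_zero {Δ a b : ℝ} (hΔ : 0 < Δ) (ha : 0 < a) (hN : 0 < N)
    (hm : 4 * (2 + Δ) < latticeSize N) {s : Config N} (hs : s.Typical Δ a b) {i j : Node N}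
    (hij : i ≠ j) : s.meet i j ≠ 0 := by
  classical
  intro h0
  have hn : (0 : ℝ) < ((2 * N : ℕ) : ℝ) := by
    have : 0 < 2 * N := by omega
    exact_mod_cast this
  have h1 : (0 : ℝ) < s.crossingCount Δ i j :=
    (mul_pos ha (Real.sqrt_pos.2 hn)).trans_le (hs i j hij).1
  have h2 : 0 < s.crossingCount Δ i j := by exact_mod_cast h1
  unfold crossingCount at h2
  obtain ⟨k, hk⟩ := Finset.card_pos.1 h2
  obtain ⟨u, -, hu⟩ := (Finset.mem_filter.1 hk).2
  have hu' := (mem_disk_iff.1 hu).2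
  -- The zero vector makes the angle `π/2` with every vector, so a disk centered at the default
  -- value is empty once its angular radius is smaller; the positive lower bound on the count
  -- excludes this.
  rw [h0, angle_zero_right] at hu'
  have hm0 : (0 : ℝ) < latticeSize N := by exact_mod_cast latticeSize_pos hN
  have h3 := hu'.trans (diskAngle_le hΔ hN)
  rw [div_le_div_iff₀ two_pos hm0] at h3
  nlinarith [Real.pi_pos]

variable {P : Placement N} {ω : Sample N}

theorem angle_location_le_of_atClosest (hN : 0 < N) {t : ℕ} {i : Node N} {z : E3}
    (hz : z ∈ greatCircle (ω.1.pole i)) (h : AtClosest P ω t i z) :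
    angle (location P ω t i) z ≤ Real.pi / latticeSize N := by
  obtain ⟨l, hl⟩ := exists_angle_latticePoint_le P ω.1 i hN hz
  exact (gdist_le_gdist_iff.1 (h l)).trans hl

open Classical in
/-- The lattice points of node `k` that lie in the disk around `z i j`. -/
def nearPoints (Δ : ℝ) (P : Placement N) (s : Config N) [NeZero (latticeSize N)]
    (i j k : Node N) : Finset (ZMod (latticeSize N)) :=
  Finset.univ.filter fun l => angle (latticePoint P s k l) (s.meet i j) ≤ diskAngle Δ N

theorem card_nearPoints_le {Δ : ℝ} (hΔ : 0 < Δ) (P : Placement N) (s : Config N)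
    [NeZero (latticeSize N)] (hN : 0 < N) (i j k : Node N) :
    (nearPoints Δ P s i j k).card ≤ 4 * ⌊2 * (2 + Δ)⌋₊ + 3 := by
  refine card_le_of_angle_le P s k hN (z := s.meet i j) (ρ := diskAngle Δ N) ?_ fun l hl =>
    (Finset.mem_filter.1 hl).2
  have hm : (0 : ℝ) < latticeSize N := by exact_mod_cast latticeSize_pos hN
  have h1 := diskAngle_le (N := N) hΔ hN
  have h2 := Nat.lt_floor_add_one (2 * (2 + Δ))
  calc 2 * diskAngle Δ N ≤ 2 * Real.pi * (2 * (2 + Δ)) / latticeSize N := by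
        refine (mul_le_mul_of_nonneg_left h1 two_pos.le).trans (le_of_eq ?_)
        ring
    _ < _ := by
        push_cast
        gcongr

-- A node with a lattice point in the disk has a circle that meets the disk. This is how typicality
-- limits the number of potential intruders.
open Classical in
theorem card_nonempty_nearPoints_le (Δ : ℝ) (P : Placement N) (s : Config N)
    [NeZero (latticeSize N)] (i j : Node N) :
    (Finset.univ.filter fun k => (nearPoints Δ P s i j k).Nonempty).card ≤
      s.crossingCount Δ i j := by
  unfold Config.crossingCount
  refine Finset.card_le_card fun k hk => ?_
  obtain ⟨l, hl⟩ := (Finset.mem_filter.1 hk).2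
  refine Finset.mem_filter.2 ⟨Finset.mem_univ _, latticePoint P s k l, latticePoint_mem P s k l, ?_⟩
  exact mem_disk_iff.2 ⟨(latticePoint_mem P s k l).1, (Finset.mem_filter.1 hl).2⟩

/-- Nodes `i` and `j` are neighbors, `i` has no other neighbor, and no node other than `i` and `j`
can disturb a transmission from `i` to `j`. -/
structure Isolated (Δ : ℝ) (P : Placement N) (ω : Sample N) (t : ℕ) (i j : Node N) : Prop where
  neighbor : Neighbor P ω t i j
  eq_of_neighbor : ∀ k, Neighbor P ω t i k → k = j
  far : ∀ k, k ≠ i → k ≠ j →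
    (1 + Δ) * gdist (location P ω t i) (location P ω t j) ≤
      gdist (location P ω t k) (location P ω t j)

/-- Let `η = π/m`. Nodes `i` and `j` are within `η` of `z i j`, all others farther than `(3 + 2Δ)η`.
Another neighbor `k` of `i` would be within `3η` of `z i j`, passing through `z i k` and the
location of `i`. For interference, `i` and `j` are at most `2η` apart, while `k` is at least `(2 +
2Δ)η` from `j`. -/
theorem isolated_of_pos_mem {Δ : ℝ} (hΔ : 0 < Δ) (hN : 0 < N) [NeZero (latticeSize N)]
    (hm : 3 + 2 * Δ ≤ latticeSize N) (hne : ∀ i j : Node N, i ≠ j → ω.1.meet i j ≠ 0)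
    {i j : Node N} (hij : i ≠ j) {u v : ZMod (latticeSize N)}
    (hu : ∀ l, gdist (latticePoint P ω.1 i u) (ω.1.meet i j) ≤
      gdist (latticePoint P ω.1 i l) (ω.1.meet i j))
    (hv : ∀ l, gdist (latticePoint P ω.1 j v) (ω.1.meet i j) ≤
      gdist (latticePoint P ω.1 j l) (ω.1.meet i j)) {t : ℕ}
    (hpos : pos ω t ∈ isolatedPositions i j u v (nearPoints Δ P ω.1 i j)) :
    Isolated Δ P ω t i j := by
  obtain ⟨hi, hj, hk⟩ := (mem_isolatedPositions hij).1 hpos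
  have hmem := Config.meet_mem (hne i j hij)
  have hci : AtClosest P ω t i (ω.1.meet i j) := by
    unfold AtClosest location
    rwa [hi]
  have hcj : AtClosest P ω t j (ω.1.meet i j) := by
    unfold AtClosest location
    rwa [hj]
  set η := Real.pi / latticeSize N with hη
  have hη0 : 0 < η := by
    have : (0 : ℝ) < latticeSize N := by exact_mod_cast latticeSize_pos hN
    have := Real.pi_pos
    positivity
  have hρ := le_diskAngle hΔ hN hm
  rw [← hη] at hρ
  have hdi := angle_location_le_of_atClosest hN hmem.1 hci
  have hdj := angle_location_le_of_atClosest hN hmem.2 hcj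
  have hfar : ∀ k, k ≠ i → k ≠ j → diskAngle Δ N < angle (location P ω t k) (ω.1.meet i j) := by
    intro k hki hkj
    by_contra hle
    exact hk k hki hkj (Finset.mem_filter.2 ⟨Finset.mem_univ _, not_lt.1 hle⟩)
  refine ⟨⟨hij, hci, hcj⟩, fun k hnk => ?_, fun k hki hkj => ?_⟩
  · by_contra hkj
    obtain ⟨hik, hck, hck'⟩ := hnk
    have hmemk := Config.meet_mem (hne i k hik)
    have h1 := angle_location_le_of_atClosest hN hmemk.1 hck
    have h2 := angle_location_le_of_atClosest hN hmemk.2 hck'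
    have h3 := hfar k hik.symm hkj
    have h4 := angle_le_angle_add_angle (location P ω t k) (ω.1.meet i k) (ω.1.meet i j)
    have h5 := angle_le_angle_add_angle (ω.1.meet i k) (location P ω t i) (ω.1.meet i j)
    rw [angle_comm (ω.1.meet i k) (location P ω t i)] at h5
    rw [← hη] at hdi h1 h2
    nlinarith [mul_pos hΔ hη0]
  · have h1 := hfar k hki hkj
    have h2 := angle_le_angle_add_angle (location P ω t k) (location P ω t j) (ω.1.meet i j)
    have h3 := angle_le_angle_add_angle (location P ω t i) (ω.1.meet i j) (location P ω t j)
    rw [angle_comm (ω.1.meet i j)] at h3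
    have hpi : 0 < √Real.pi := Real.sqrt_pos.2 Real.pi_pos
    rw [gdist, gdist, ← mul_div_assoc, div_le_div_iff_of_pos_right (by positivity)]
    have h4 : (1 + Δ) * angle (location P ω t i) (location P ω t j) ≤ (1 + Δ) * (2 * η) :=
      mul_le_mul_of_nonneg_left (by linarith) (by linarith)
    linarith

/-- With a single neighbor the ranking has no influence. The receiver is the one possible
transmitter not covered by `far`, and its coin silences it. -/
theorem Isolated.success_txA {Δ : ℝ} {t : ℕ} {c : Fin N} {r : Node N}
    (h : Isolated Δ P ω t (ω.1.src c) r) (hξ : ω.2.2 t ∈ coinsA (ω.1.src c) r) :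
    Success Δ (location P ω t) (TxA P ω t) (ω.1.src c) r := by
  obtain ⟨⟨h1, h2⟩, h3⟩ := hξ
  refine ⟨⟨⟨c, rfl⟩, h1, h2, h.neighbor, fun k hk => ?_⟩, fun k hk hT => ?_⟩
  · rw [h.eq_of_neighbor k hk]
  · obtain ⟨l, _, hact, _⟩ := hT
    refine h.far k hk ?_
    rintro rfl
    rw [h3] at hact
    exact Bool.false_ne_true hact

theorem Isolated.success_txB {Δ : ℝ} {t : ℕ} {c : Fin N} {r : Node N}
    {q : Node N → Fin N → ℕ} (h : Isolated Δ P ω t r (ω.1.dst c))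
    (hξ : ω.2.2 t ∈ coinsB r (ω.1.dst c)) (hq : 0 < q r c) :
    Success Δ (location P ω t) (TxB P ω t q) r (ω.1.dst c) := by
  obtain ⟨h1, h2⟩ := hξ
  refine ⟨⟨h1, ⟨⟨h.neighbor, c, rfl⟩, fun k hk => ?_⟩, c, rfl, hq⟩, fun k hk hT => ?_⟩
  · rw [h.eq_of_neighbor k hk.1]
  · obtain ⟨l, hact, _⟩ := hT
    refine h.far k hk ?_
    rintro rfl
    rw [h2] at hact
    exact Bool.false_ne_true hact

/-! ### Throughput in a typical configuration -/

/-- Uses `1 - x ≥ exp(-2x)` on `[0, 1/2]` and `β ≤ 2bm`; the bound no longer depends on `m`. -/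
theorem exp_le_one_sub_div_pow {Q β : ℕ} {m b : ℝ} (hm : 1 ≤ m) (hQ : 2 * (Q : ℝ) ≤ m)
    (hβ : (β : ℝ) ≤ b * (m + 1)) (hb : 0 ≤ b) :
    Real.exp (-(4 * Q * b)) ≤ (1 - Q / m) ^ β := by
  have hx : (Q : ℝ) / m ≤ 1 / 2 := by rw [div_le_div_iff₀ (by linarith) two_pos]; linarith
  have hx0 : 0 ≤ (Q : ℝ) / m := by positivity
  have h1 : Real.exp (-(2 * (Q / m))) ≤ 1 - Q / m := by
    rw [Real.exp_neg, inv_le_comm₀ (Real.exp_pos _) (by linarith)]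
    have h2 := Real.add_one_le_exp (2 * (Q / m))
    refine le_trans ?_ h2
    rw [inv_le_iff_one_le_mul₀ (by linarith)]
    nlinarith
  refine le_trans ?_ (pow_le_pow_left₀ (Real.exp_pos _).le h1 β)
  rw [← Real.exp_nat_mul]
  refine Real.exp_le_exp.2 ?_
  have h3 : (β : ℝ) ≤ 2 * b * m := by nlinarith
  have h4 : (β : ℝ) * (Q / m) ≤ 2 * b * m * (Q / m) := mul_le_mul_of_nonneg_right h3 hx0
  have h5 : 2 * b * m * (Q / m) = 2 * b * Q := by field_simp
  nlinarith

open Classical in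
/-- Isolated pairs with favorable coins have their stationary frequencies. -/
def RegularFrequencies (p α : unitInterval) (ω : Sample N) [NeZero (latticeSize N)] : Prop :=
  ∀ (i j : Node N) (u v : ZMod (latticeSize N)) (K : Node N → Finset (ZMod (latticeSize N))),
    i ≠ j →
    Tendsto (fun t : ℕ => ((∑ τ ∈ Finset.range t,
      if pos ω τ ∈ isolatedPositions i j u v K ∧ ω.2.2 τ ∈ coinsA i j then 1 else 0 : ℕ) : ℝ) / t)
      atTop (𝓝 ((isolatedPositions i j u v K).card / (latticeSize N : ℝ) ^ (2 * N) *
        (p * α * (1 - p)))) ∧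
    Tendsto (fun t : ℕ => ((∑ τ ∈ Finset.range t,
      if pos ω τ ∈ isolatedPositions i j u v K ∧ ω.2.2 τ ∈ coinsB i j then 1 else 0 : ℕ) : ℝ) / t)
      atTop (𝓝 ((isolatedPositions i j u v K).card / (latticeSize N : ℝ) ^ (2 * N) *
        (p * (1 - p))))

theorem ae_regularFrequencies {p α : unitInterval} (hp : 0 < p) (hp1 : p < 1)
    (hα : 0 < α) (hα1 : α < 1) (hN : 0 < N) [NeZero (latticeSize N)] :
    ∀ᵐ ω ∂(law p α N), RegularFrequencies p α ω := by
  classical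
  unfold RegularFrequencies
  -- All finitely many data are treated at once, since the relevant `u`, `v`, `K` depend on the
  -- configuration and on the placement.
  refine ae_all_iff.2 fun i => ae_all_iff.2 fun j => ae_all_iff.2 fun u => ae_all_iff.2 fun v =>
    ae_all_iff.2 fun K => ?_
  by_cases hij : i = j
  · exact Eventually.of_forall fun ω h => absurd hij h
  · have hA := ae_tendsto_frequency hp hp1 hα hα1 hN (isolatedPositions i j u v K) (coinsA i j)
    have hB := ae_tendsto_frequency hp hp1 hα hα1 hN (isolatedPositions i j u v K) (coinsB i j)
    rw [pi_noiseMeasure_real_coinsA p α hij] at hA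
    rw [pi_noiseMeasure_real_coinsB p α hij] at hB
    filter_upwards [hA, hB] with ω h1 h2 _
    exact ⟨h1, h2⟩

/-- The number of lattice points in a disk is bounded by this constant. -/
def nearBound (Δ : ℝ) : ℕ := 4 * ⌊2 * (2 + Δ)⌋₊ + 3

/-- A lower bound, up to the number of nodes, for the rate between any two nodes. -/
def rateConst (Δ b : ℝ) (p α : unitInterval) : ℝ :=
  Real.exp (-(4 * nearBound Δ * b)) * (p * α * (1 - p))

theorem rateConst_pos (Δ b : ℝ) {p α : unitInterval} (hp : 0 < p) (hp1 : p < 1) (hα : 0 < α) :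
    0 < rateConst Δ b p α := by
  have h1 : (0 : ℝ) < p := hp
  have h2 : (0 : ℝ) < 1 - p := sub_pos.2 hp1
  have h3 : (0 : ℝ) < α := hα
  unfold rateConst
  positivity

/-- The stationary frequency of isolation of a pair in a typical configuration. -/
theorem le_frequency_isolated {Δ a b : ℝ} (hΔ : 0 < Δ) (hb : 0 ≤ b) (hN : 0 < N)
    [NeZero (latticeSize N)] (hQ : 2 * (nearBound Δ : ℝ) ≤ latticeSize N) (P : Placement N)
    {s : Config N} (hs : s.Typical Δ a b) {i j : Node N} (hij : i ≠ j)
    (u v : ZMod (latticeSize N)) :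
    Real.exp (-(4 * nearBound Δ * b)) / (2 * N : ℕ) ≤
      (isolatedPositions i j u v (nearPoints Δ P s i j)).card /
        (latticeSize N : ℝ) ^ (2 * N) := by
  classical
  have hm1 : (1 : ℝ) ≤ latticeSize N := by exact_mod_cast latticeSize_pos hN
  have hQ' : nearBound Δ ≤ latticeSize N := by
    have : 2 * nearBound Δ ≤ latticeSize N := by exact_mod_cast hQ
    omega
  have h1 := le_card_isolatedPositions hij u v (card_nearPoints_le hΔ P s hN i j) hQ'
    (card_nonempty_nearPoints_le Δ P s i j)
  refine le_trans ?_ h1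
  have hβ : (s.crossingCount Δ i j : ℝ) ≤ b * (latticeSize N + 1) :=
    (hs i j hij).2.trans (mul_le_mul_of_nonneg_left sqrt_le_latticeSize_add_one hb)
  have h2 := exp_le_one_sub_div_pow hm1 hQ hβ hb
  have h3 : (latticeSize N : ℝ) ^ 2 ≤ (2 * N : ℕ) := by
    have : latticeSize N ^ 2 ≤ 2 * N := Nat.sqrt_le' _
    exact_mod_cast this
  have h4 : (0 : ℝ) < (latticeSize N : ℝ) ^ 2 := by positivity
  exact div_le_div₀ ((Real.exp_pos _).le.trans h2) h2 h4 h3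

/-- The rate at which a relay forwards packets of an S-D pair. -/
theorem eventually_le_sum_departures {Δ a b : ℝ} (hΔ : 0 < Δ) (ha : 0 < a) (hb : 0 ≤ b)
    {p α : unitInterval} (hp : 0 < p) (hp1 : p < 1) (hα : 0 < α) (hα1 : α < 1) (hN : 0 < N)
    [NeZero (latticeSize N)] (hm : 4 * (2 + Δ) < latticeSize N)
    (hQ : 2 * (nearBound Δ : ℝ) ≤ latticeSize N) (hs : ω.1.Typical Δ a b)
    (hreg : RegularFrequencies p α ω) {c : Fin N} {r : Node N} (hsrc : ω.1.src c ≠ r)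
    (hdst : r ≠ ω.1.dst c) :
    ∀ᶠ t : ℕ in atTop, rateConst Δ b p α / (4 * N) * t ≤
      ((∑ τ ∈ Finset.range t, departures Δ P ω r c τ : ℕ) : ℝ) := by
  classical
  have hne : ∀ i j : Node N, i ≠ j → ω.1.meet i j ≠ 0 :=
    fun i j hij => hs.meet_ne_zero hΔ ha hN hm hij
  have hm3 : 3 + 2 * Δ ≤ latticeSize N := by linarith
  have hclosest : ∀ (i : Node N) (z : E3), ∃ u, ∀ l,
      gdist (latticePoint P ω.1 i u) z ≤ gdist (latticePoint P ω.1 i l) z :=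
    fun i z => Finite.exists_min fun l => gdist (latticePoint P ω.1 i l) z
  obtain ⟨u, hu⟩ := hclosest (ω.1.src c) (ω.1.meet (ω.1.src c) r)
  obtain ⟨v, hv⟩ := hclosest r (ω.1.meet (ω.1.src c) r)
  obtain ⟨u', hu'⟩ := hclosest r (ω.1.meet r (ω.1.dst c))
  obtain ⟨v', hv'⟩ := hclosest (ω.1.dst c) (ω.1.meet r (ω.1.dst c))
  have hA := (hreg (ω.1.src c) r u v (nearPoints Δ P ω.1 (ω.1.src c) r) hsrc).1
  have hB := (hreg r (ω.1.dst c) u' v' (nearPoints Δ P ω.1 r (ω.1.dst c)) hdst).2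
  have hNR : (0 : ℝ) < N := by exact_mod_cast hN
  have hp' : (0 : ℝ) < p := hp
  have hp1' : (0 : ℝ) < 1 - p := sub_pos.2 hp1
  have hα' : (0 : ℝ) < α := hα
  have hα1' : (α : ℝ) < 1 := hα1
  -- Half of the guaranteed rate is given up because the queue lemma needs a target strictly below
  -- the arrival and service rates.
  have hrate : rateConst Δ b p α / (4 * N) <
      Real.exp (-(4 * nearBound Δ * b)) / (2 * N : ℕ) * (p * α * (1 - p)) := by
    have hpos := rateConst_pos Δ b hp hp1 hα
    have : Real.exp (-(4 * nearBound Δ * b)) / (2 * N : ℕ) * (p * α * (1 - p)) =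
        rateConst Δ b p α / (2 * N) := by
      unfold rateConst
      push_cast
      ring
    rw [this]
    exact div_lt_div_of_pos_left hpos (by positivity) (by linarith)
  -- Minorants: isolation of source and relay with coins for A, and of relay and destination with
  -- coins for B. Neither refers to the queues, so both have known frequencies.
  refine eventually_mul_le_departures (q := fun t => queue Δ P ω t r c)
    (arr := arrivals Δ P ω r c) rfl (queue_balance Δ P ω r c) (fun t => ?_) (fun t ht => ?_)
    hA hB ?_ ?_
  · split_ifs with h
    · have hiso := isolated_of_pos_mem hΔ hN hm3 hne hsrc hu hv h.1
      rw [arrivals, if_pos ⟨hiso.success_txA h.2, hdst⟩]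
    · exact Nat.zero_le _
  · split_ifs with h
    · have hiso := isolated_of_pos_mem hΔ hN hm3 hne hdst hu' hv' h.1
      rw [departures, if_pos (hiso.success_txB h.2 ht)]
    · exact Nat.zero_le _
  · refine hrate.trans_le (mul_le_mul_of_nonneg_right ?_ (by positivity))
    exact le_frequency_isolated hΔ hb hN hQ P hs hsrc u v
  · refine hrate.trans_le (mul_le_mul ?_ ?_ (by positivity) (by positivity))
    · exact le_frequency_isolated hΔ hb hN hQ P hs hdst u' v'
    · have : (p : ℝ) * α ≤ p := mul_le_of_le_one_right hp'.le hα1'.le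
      exact mul_le_mul_of_nonneg_right this hp1'.le

/-- The rate of every S-D pair in a typical configuration. -/
theorem le_liminf_bitsPi_of_typical {Δ a b W : ℝ} (hΔ : 0 < Δ) (ha : 0 < a) (hb : 0 ≤ b)
    (hW : 0 < W) {p α : unitInterval} (hp : 0 < p) (hp1 : p < 1) (hα : 0 < α) (hα1 : α < 1)
    (hN : 2 ≤ N) [NeZero (latticeSize N)] (hm : 4 * (2 + Δ) < latticeSize N)
    (hQ : 2 * (nearBound Δ : ℝ) ≤ latticeSize N) (hs : ω.1.Typical Δ a b)
    (hreg : RegularFrequencies p α ω) (c : Fin N) :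
    W * rateConst Δ b p α / 8 ≤ liminf (fun t : ℕ => bitsPi Δ W a b P ω c t / t) atTop := by
  classical
  refine le_liminf_bitsPi hW.le Δ a b P ω c ?_
  -- There are `2N - 2 ≥ N` relays, each forwarding at rate `rateConst / (4N)`; with `W/2` bits per
  -- packet this gives the factor `1/8`.
  set R : Finset (Node N) := {ω.1.src c, ω.1.dst c}ᶜ with hR
  have hRcard : N ≤ R.card := by
    rw [hR, Finset.card_compl, Finset.card_pair (ω.1.src_ne_dst c c), Fintype.card_fin]
    omega
  have hev : ∀ᶠ t : ℕ in atTop, ∀ r ∈ R, rateConst Δ b p α / (4 * N) * t ≤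
      ((∑ τ ∈ Finset.range t, departures Δ P ω r c τ : ℕ) : ℝ) := by
    refine (Filter.eventually_all_finset R).2 fun r hr => ?_
    simp only [hR, Finset.mem_compl, Finset.mem_insert, Finset.mem_singleton, not_or] at hr
    exact eventually_le_sum_departures hΔ ha hb hp hp1 hα hα1 (by omega) hm hQ hs hreg
      (Ne.symm hr.1) hr.2
  filter_upwards [hev, eventually_gt_atTop 0] with t ht htpos
  have htR : (0 : ℝ) < t := by exact_mod_cast htpos
  have hNR : (0 : ℝ) < N := by
    have : 0 < N := by omega
    exact_mod_cast this
  have hpos := rateConst_pos Δ b hp hp1 hα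
  have h1 : ∑ r ∈ R, ∑ τ ∈ Finset.range t, departures Δ P ω r c τ ≤
      ∑ τ ∈ Finset.range t, delivered Δ P ω τ c := by
    rw [Finset.sum_comm]
    refine Finset.sum_le_sum fun τ _ => ?_
    rw [delivered_eq]
    exact (Finset.sum_le_univ_sum_of_nonneg fun _ => Nat.zero_le _).trans (Nat.le_add_left _ _)
  have h2 : rateConst Δ b p α / 4 * t ≤
      ((∑ τ ∈ Finset.range t, delivered Δ P ω τ c : ℕ) : ℝ) := by
    calc rateConst Δ b p α / 4 * t = N * (rateConst Δ b p α / (4 * N) * t) := by field_simp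
      _ ≤ R.card * (rateConst Δ b p α / (4 * N) * t) := by
          refine mul_le_mul_of_nonneg_right ?_ (by positivity)
          exact_mod_cast hRcard
      _ = ∑ r ∈ R, rateConst Δ b p α / (4 * N) * t := by rw [Finset.sum_const, nsmul_eq_mul]
      _ ≤ ∑ r ∈ R, ((∑ τ ∈ Finset.range t, departures Δ P ω r c τ : ℕ) : ℝ) :=
          Finset.sum_le_sum ht
      _ ≤ _ := by exact_mod_cast h1
  rw [le_div_iff₀ htR, bitsPi, if_pos hs, bitsSigma]
  nlinarith [mul_le_mul_of_nonneg_left h2 hW.le]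

end

section

open scoped Pointwise

/-! ### The uniform measure of bands around great circles -/

theorem exists_orthonormalBasis_zero {z : E3} (hz : ‖z‖ = 1) :
    ∃ b : OrthonormalBasis (Fin 3) ℝ E3, b 0 = z := by
  have hv : Orthonormal ℝ (({0} : Set (Fin 3)).domRestrict fun _ => z) := by
    refine ⟨fun _ => hz, fun i j hij => absurd (Subsingleton.elim i j) hij⟩
  obtain ⟨b, hb⟩ := hv.exists_orthonormalBasis_extension_of_card_eq (by simp)
  exact ⟨b, hb 0 rfl⟩

theorem volume_box (b : OrthonormalBasis (Fin 3) ℝ E3) (l u : Fin 3 → ℝ) :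
    volume {y : E3 | ∀ i, inner ℝ (b i) y ∈ Set.Icc (l i) (u i)} =
      ∏ i, ENNReal.ofReal (u i - l i) := by
  have hmp := (PiLp.volume_preserving_ofLp (Fin 3)).comp b.measurePreserving_repr
  have hset : {y : E3 | ∀ i, inner ℝ (b i) y ∈ Set.Icc (l i) (u i)} =
      (WithLp.ofLp ∘ b.repr) ⁻¹' Set.univ.pi fun i => Set.Icc (l i) (u i) := by
    ext y
    simp only [Set.mem_ofPred_eq, Set.mem_preimage, Set.mem_univ_pi, Function.comp_apply,
      OrthonormalBasis.repr_apply_apply]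
  rw [hset, hmp.measure_preimage
    (MeasurableSet.univ_pi fun _ => measurableSet_Icc).nullMeasurableSet, volume_pi_pi]
  simp [Real.volume_Icc]

theorem sphereUniform_apply {s : Set S2} (hs : MeasurableSet s) :
    sphereUniform s = (volume (Metric.ball (0 : E3) 1))⁻¹ *
      volume (Set.Ioo (0 : ℝ) 1 • ((↑) '' s : Set E3)) := by
  rw [sphereUniform, Measure.smul_apply, smul_eq_mul, Measure.toSphere_apply_univ,
    Measure.toSphere_apply' _ hs, ENNReal.mul_inv (by simp) (by simp)]
  rw [mul_mul_mul_comm, ENNReal.inv_mul_cancel (by simp) (by simp), one_mul]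

theorem measurableSet_band (z : E3) (ε : ℝ) :
    MeasurableSet {x : S2 | |inner ℝ (x : E3) z| ≤ ε} := by
  refine measurableSet_le ?_ measurable_const
  fun_prop

theorem abs_inner_le_one {u v : E3} (hu : ‖u‖ ≤ 1) (hv : ‖v‖ ≤ 1) : |inner ℝ u v| ≤ 1 :=
  (abs_real_inner_le_norm u v).trans (mul_le_one₀ hu (norm_nonneg _) hv)

/-- In an orthonormal basis starting with `z`, the cone over the band fits in the box `[-ε, ε] ×
[-1, 1]²`. -/
theorem volume_cone_band_le {z : E3} (hz : ‖z‖ = 1) {ε : ℝ} (hε : 0 ≤ ε) :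
    volume (Set.Ioo (0 : ℝ) 1 • ((↑) '' {x : S2 | |inner ℝ (x : E3) z| ≤ ε} : Set E3)) ≤
      ENNReal.ofReal (8 * ε) := by
  obtain ⟨b, hb⟩ := exists_orthonormalBasis_zero hz
  have hbox := volume_box b ![-ε, -1, -1] ![ε, 1, 1]
  have hprod : ∏ i, ENNReal.ofReal ((![ε, 1, 1] : Fin 3 → ℝ) i - (![-ε, -1, -1] : Fin 3 → ℝ) i) =
      ENNReal.ofReal (8 * ε) := by
    rw [← ENNReal.ofReal_prod_of_nonneg]
    · congr 1
      simp [Fin.prod_univ_three]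
      ring
    · intro i _
      fin_cases i
      · simp; linarith
      · norm_num
      · norm_num
  rw [hprod] at hbox
  rw [← hbox]
  refine measure_mono ?_
  rintro _ ⟨r, hr, _, ⟨x, hx, rfl⟩, rfl⟩
  have hr1 : |r| ≤ 1 := by rw [abs_of_pos hr.1]; exact hr.2.le
  have hx' : |inner ℝ (x : E3) z| ≤ ε := hx
  have hi : ∀ i, |inner ℝ (b i) (r • (x : E3))| ≤ 1 := fun i =>
    abs_inner_le_one (by simp) (by rw [norm_smul, S2.norm_eq, mul_one]; exact hr1)
  have h0 : |inner ℝ (b 0) (r • (x : E3))| ≤ ε := by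
    rw [hb, real_inner_smul_right, abs_mul, real_inner_comm]
    exact (mul_le_of_le_one_left (abs_nonneg _) hr1).trans hx'
  intro i
  fin_cases i
  · simpa using abs_le.1 h0
  · simpa using abs_le.1 (hi 1)
  · simpa using abs_le.1 (hi 2)

/-- The cone contains a box of volume `ε/16`. Its second coordinate is at least `1/4`, so projecting
to the sphere enlarges the `z`-coordinate at most fourfold, and the box lies inside the unit ball.
-/
theorem le_volume_cone_band {z : E3} (hz : ‖z‖ = 1) {ε : ℝ} (hε : 0 ≤ ε) (hε1 : ε ≤ 1) :
    ENNReal.ofReal (ε / 16) ≤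
      volume (Set.Ioo (0 : ℝ) 1 • ((↑) '' {x : S2 | |inner ℝ (x : E3) z| ≤ ε} : Set E3)) := by
  obtain ⟨b, hb⟩ := exists_orthonormalBasis_zero hz
  have hbox := volume_box b ![-(ε / 4), 1 / 4, 0] ![ε / 4, 1 / 2, 1 / 2]
  have hprod : ∏ i, ENNReal.ofReal ((![ε / 4, 1 / 2, 1 / 2] : Fin 3 → ℝ) i -
      (![-(ε / 4), 1 / 4, 0] : Fin 3 → ℝ) i) = ENNReal.ofReal (ε / 16) := by
    rw [← ENNReal.ofReal_prod_of_nonneg]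
    · congr 1
      simp [Fin.prod_univ_three]
      ring
    · intro i _
      fin_cases i
      · simp; linarith
      · norm_num
      · norm_num
  rw [hprod] at hbox
  rw [← hbox]
  refine measure_mono fun y hy => ?_
  have h0 := hy 0
  have h1 := hy 1
  have h2 := hy 2
  simp only [Matrix.cons_val_zero, Matrix.cons_val_one, Matrix.cons_val, hb, Set.mem_Icc]
    at h0 h1 h2
  have hnorm : ‖y‖ ^ 2 = inner ℝ z y ^ 2 + inner ℝ (b 1) y ^ 2 + inner ℝ (b 2) y ^ 2 := by
    have := b.sum_sq_norm_inner_right y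
    rw [← this, Fin.sum_univ_three, hb]
    simp
  have hlt : ‖y‖ < 1 := by
    rw [← sq_lt_one_iff₀ (norm_nonneg y), hnorm]
    nlinarith
  have hge : 1 / 4 ≤ ‖y‖ := by
    have : inner ℝ (b 1) y ≤ ‖b 1‖ * ‖y‖ := real_inner_le_norm _ _
    simp at this
    linarith
  have hpos : 0 < ‖y‖ := by linarith
  have hunit : ‖‖y‖⁻¹ • y‖ = 1 := by
    rw [norm_smul, norm_inv, norm_norm, inv_mul_cancel₀ hpos.ne']
  refine ⟨‖y‖, ⟨hpos, hlt⟩, ‖y‖⁻¹ • y, ⟨⟨‖y‖⁻¹ • y, by simpa using hunit⟩, ?_, rfl⟩, ?_⟩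
  · change |inner ℝ (‖y‖⁻¹ • y) z| ≤ ε
    rw [real_inner_smul_left, abs_mul, abs_of_pos (inv_pos.2 hpos), real_inner_comm,
      inv_mul_le_iff₀ hpos]
    have : |inner ℝ z y| ≤ ε / 4 := abs_le.2 h0
    nlinarith
  · simp only [smul_smul, mul_inv_cancel₀ hpos.ne', one_smul]

/-- The measure of a band around a great circle is of the order of its width. -/
theorem exists_sphereUniform_band_bounds : ∃ C₀ C₁ : ℝ, 0 < C₀ ∧ 0 < C₁ ∧
    (∀ z : E3, ‖z‖ = 1 → ∀ ε : ℝ, 0 ≤ ε →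
      sphereUniform.real {x : S2 | |inner ℝ (x : E3) z| ≤ ε} ≤ C₁ * ε) ∧
    ∀ z : E3, ‖z‖ = 1 → ∀ ε : ℝ, 0 ≤ ε → ε ≤ 1 →
      C₀ * ε ≤ sphereUniform.real {x : S2 | |inner ℝ (x : E3) z| ≤ ε} := by
  set V := volume (Metric.ball (0 : E3) 1) with hV
  have hV0 : V ≠ 0 := (Metric.measure_ball_pos volume _ one_pos).ne'
  have hVt : V ≠ ⊤ := measure_ball_lt_top.ne
  have hVpos : 0 < V.toReal := ENNReal.toReal_pos hV0 hVt
  refine ⟨V.toReal⁻¹ / 16, V.toReal⁻¹ * 8, by positivity, by positivity, ?_, ?_⟩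
  · intro z hz ε hε
    rw [measureReal_def, sphereUniform_apply (measurableSet_band z ε), ← hV, ENNReal.toReal_mul,
      ENNReal.toReal_inv, mul_assoc]
    refine mul_le_mul_of_nonneg_left ?_ (by positivity)
    refine ENNReal.toReal_le_of_le_ofReal (by positivity) (volume_cone_band_le hz hε)
  · intro z hz ε hε hε1
    rw [measureReal_def, sphereUniform_apply (measurableSet_band z ε), ← hV, ENNReal.toReal_mul,
      ENNReal.toReal_inv, div_mul_eq_mul_div, mul_div_assoc]
    refine mul_le_mul_of_nonneg_left ?_ (by positivity)
    rw [← ENNReal.toReal_ofReal (show (0 : ℝ) ≤ ε / 16 by positivity)]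
    refine ENNReal.toReal_mono ?_ (le_volume_cone_band hz hε hε1)
    exact ne_top_of_le_ne_top ENNReal.ofReal_ne_top (volume_cone_band_le hz hε)

/-! ### Concentration of counts -/

open Classical in
/-- The number of coordinates that lie in `S`. -/
def hitCount {ι X : Type*} [Fintype ι] (S : Set X) (y : ι → X) : ℕ :=
  (Finset.univ.filter fun k => y k ∈ S).card

section HitCount

variable {ι X : Type*} [Fintype ι]

theorem exp_mul_hitCount (t : ℝ) (S : Set X) (y : ι → X) :
    Real.exp (t * hitCount S y) = ∏ k, (S.indicator (fun _ => Real.exp t - 1) (y k) + 1) := by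
  classical
  have : ∀ k, S.indicator (fun _ => Real.exp t - 1) (y k) + 1 =
      if y k ∈ S then Real.exp t else 1 := by
    intro k
    by_cases h : y k ∈ S <;> simp [h]
  simp only [this]
  rw [Finset.prod_ite, Finset.prod_const, Finset.prod_const_one, mul_one, hitCount, mul_comm,
    Real.exp_nat_mul]

variable [MeasurableSpace X] {μ : Measure X} [IsProbabilityMeasure μ] {S : Set X}

/-- The count is binomial; `1 + x ≤ exp x` bounds its moment generating function by the Poisson one
with the same mean. The tail bounds below use `t = 1` and `t = -1`. -/
theorem integral_exp_mul_hitCount_le (hS : MeasurableSet S) (t : ℝ) :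
    Integrable (fun y : ι → X => Real.exp (t * hitCount S y)) (Measure.pi fun _ => μ) ∧
      mgf (fun y : ι → X => (hitCount S y : ℝ)) (Measure.pi fun _ => μ) t ≤
        Real.exp (Fintype.card ι * μ.real S * (Real.exp t - 1)) := by
  have hint : Integrable (fun x => S.indicator (fun _ => Real.exp t - 1) x + 1) μ :=
    ((integrable_const _).indicator hS).add (integrable_const _)
  have hval : ∫ x, (S.indicator (fun _ => Real.exp t - 1) x + 1) ∂μ =
      μ.real S * (Real.exp t - 1) + 1 := by
    rw [integral_add ((integrable_const _).indicator hS) (integrable_const _),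
      integral_indicator_const _ hS]
    simp
  constructor
  · simp only [exp_mul_hitCount]
    exact Integrable.fintype_prod fun _ => hint
  · unfold mgf
    simp only [exp_mul_hitCount]
    rw [integral_fintype_prod_eq_prod (fun _ x => S.indicator (fun _ => Real.exp t - 1) x + 1)]
    simp only [hval, Finset.prod_const, Finset.card_univ]
    rw [mul_assoc, Real.exp_nat_mul]
    refine pow_le_pow_left₀ ?_ (Real.add_one_le_exp _) _
    have h1 : μ.real S ≤ 1 := measureReal_le_one
    have h0 : 0 ≤ μ.real S := measureReal_nonneg
    nlinarith [Real.exp_pos t]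

theorem measure_le_hitCount_le (hS : MeasurableSet S) (T : ℝ) :
    (Measure.pi fun _ : ι => μ).real {y | T ≤ hitCount S y} ≤
      Real.exp (2 * (Fintype.card ι * μ.real S) - T) := by
  obtain ⟨hi, hm⟩ := integral_exp_mul_hitCount_le (ι := ι) (μ := μ) hS 1
  refine (measure_ge_le_exp_mul_mgf T zero_le_one hi).trans ?_
  refine (mul_le_mul_of_nonneg_left hm (Real.exp_pos _).le).trans ?_
  rw [← Real.exp_add]
  refine Real.exp_le_exp.2 ?_
  have h1 : (0 : ℝ) ≤ Fintype.card ι * μ.real S := by positivity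
  have h2 := Real.exp_one_lt_d9
  nlinarith

theorem measure_hitCount_le_le (hS : MeasurableSet S) (T : ℝ) :
    (Measure.pi fun _ : ι => μ).real {y | (hitCount S y : ℝ) ≤ T} ≤
      Real.exp (T - Fintype.card ι * μ.real S / 2) := by
  obtain ⟨hi, hm⟩ := integral_exp_mul_hitCount_le (ι := ι) (μ := μ) hS (-1)
  refine (measure_le_le_exp_mul_mgf T (by norm_num) hi).trans ?_
  refine (mul_le_mul_of_nonneg_left hm (Real.exp_pos _).le).trans ?_
  rw [← Real.exp_add]
  refine Real.exp_le_exp.2 ?_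
  have h1 : (0 : ℝ) ≤ Fintype.card ι * μ.real S := by positivity
  have h2 : Real.exp (-1) ≤ 1 / 2 := by
    rw [Real.exp_neg, inv_le_comm₀ (Real.exp_pos _) (by norm_num)]
    have := Real.exp_one_gt_d9
    norm_num
    linarith
  nlinarith

end HitCount

end

section

open InnerProductGeometry

/-! ### Great circles that meet a disk -/

section Disk

variable {N : ℕ}

theorem norm_sub_le_angle {u z : E3} (hu : ‖u‖ = 1) (hz : ‖z‖ = 1) : ‖z - u‖ ≤ angle u z := by
  refine abs_le_of_sq_le_sq' ?_ (angle_nonneg _ _) |>.2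
  rw [norm_sub_sq_real, hu, hz, real_inner_comm]
  have h1 : inner ℝ u z = Real.cos (angle u z) := by rw [cos_angle, hu, hz]; simp
  have h2 := Real.one_sub_sq_div_two_le_cos (x := angle u z)
  rw [h1]
  linarith

theorem abs_inner_le_of_meets_disk {Δ : ℝ} {x : S2} {z : E3} (hz : ‖z‖ = 1)
    (h : (greatCircle x ∩ disk z (diskRadius Δ N)).Nonempty) :
    |inner ℝ (x : E3) z| ≤ diskAngle Δ N := by
  obtain ⟨u, hu, hd⟩ := h
  have hd' := mem_disk_iff.1 hd
  have h1 : inner ℝ (x : E3) z = inner ℝ (x : E3) (z - u) := by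
    rw [inner_sub_right, hu.2, sub_zero]
  rw [h1]
  refine (abs_real_inner_le_norm _ _).trans ?_
  rw [S2.norm_eq, one_mul]
  exact (norm_sub_le_angle hd'.1 hz).trans hd'.2

/-- The normalized projection of `z` to the plane of the circle is a common point: its angle to `z`
has cosine `√(1 - s²)`. The factor `2/π` comes from Jordan's inequality `2ρ/π ≤ sin ρ`. -/
theorem meets_disk_of_abs_inner_le {Δ : ℝ} {x : S2} {z : E3} (hz : ‖z‖ = 1)
    (hρ0 : 0 ≤ diskAngle Δ N) (hρ : diskAngle Δ N < Real.pi / 2)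
    (h : |inner ℝ (x : E3) z| ≤ 2 / Real.pi * diskAngle Δ N) :
    (greatCircle x ∩ disk z (diskRadius Δ N)).Nonempty := by
  set ρ := diskAngle Δ N with hρdef
  set s : ℝ := inner ℝ (x : E3) z with hs
  have hsin : |s| ≤ Real.sin ρ := h.trans (Real.mul_le_sin hρ0 hρ.le)
  have hcos : 0 < Real.cos ρ := Real.cos_pos_of_mem_Ioo ⟨by linarith [Real.pi_pos], hρ⟩
  have hsq : Real.cos ρ ^ 2 ≤ 1 - s ^ 2 := by
    have h1 : s ^ 2 ≤ Real.sin ρ ^ 2 := sq_le_sq' (abs_le.1 hsin).1 (abs_le.1 hsin).2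
    nlinarith [Real.sin_sq_add_cos_sq ρ]
  set w : E3 := z - s • (x : E3) with hw
  have hxw : inner ℝ (x : E3) w = (0 : ℝ) := by
    rw [hw, inner_sub_right, real_inner_smul_right, S2.inner_self, ← hs]
    ring
  have hwz : inner ℝ w z = 1 - s ^ 2 := by
    rw [hw, inner_sub_left, real_inner_smul_left, ← hs, inner_self_eq_one hz]
    ring
  have hww : ‖w‖ ^ 2 = 1 - s ^ 2 := by
    rw [← hwz, ← real_inner_self_eq_norm_sq]
    conv_lhs => rw [hw, inner_sub_right, real_inner_smul_right, ← hw, real_inner_comm (x : E3) w,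
      hxw, mul_zero, sub_zero]
  have hwpos : 0 < ‖w‖ := by
    have : 0 < ‖w‖ ^ 2 := by rw [hww]; nlinarith
    exact (norm_nonneg w).lt_of_ne' fun h0 => by simp [h0] at this
  have hunit : ‖‖w‖⁻¹ • w‖ = 1 := by
    rw [norm_smul, norm_inv, norm_norm, inv_mul_cancel₀ hwpos.ne']
  refine ⟨‖w‖⁻¹ • w, ⟨hunit, ?_⟩, mem_disk_iff.2 ⟨hunit, ?_⟩⟩
  · rw [real_inner_smul_right, hxw, mul_zero]
  · rw [angle_eq_arccos hunit hz, real_inner_smul_left, hwz, ← hww, sq, ← mul_assoc,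
      inv_mul_cancel₀ hwpos.ne', one_mul, ← hρdef]
    have h1 : Real.cos ρ ≤ ‖w‖ := by
      refine (abs_le_of_sq_le_sq' ?_ (norm_nonneg w)).2
      rw [hww]
      exact hsq
    refine (Real.arccos_le_arccos h1).trans_eq ?_
    exact Real.arccos_cos hρ0 (by linarith [Real.pi_pos])

/-- The poles of the great circles that come within an angle of about `ε` of `z`. -/
def band (z : E3) (ε : ℝ) : Set S2 := {x | |inner ℝ (x : E3) z| ≤ ε}

theorem band_neg (z : E3) (ε : ℝ) : band (-z) ε = band z ε := by
  simp [band]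

theorem Config.exists_meet_eq (s : Config N) {i j : Node N} (hij : i < j) :
    s.meet i j = crossing (s.1 i) (s.1 j) ∨ s.meet i j = -crossing (s.1 i) (s.1 j) := by
  rw [meet, if_pos hij, meetLt]
  split_ifs
  · exact Or.inl rfl
  · exact Or.inr rfl

/-- Bands are symmetric under `z ↦ -z`, so the coin choosing between the antipodal points drops out
and the bounding counts depend on the poles only. -/
theorem Config.crossingCount_bounds {Δ : ℝ} (s : Config N) {i j : Node N} (hij : i < j)
    (hρ0 : 0 ≤ diskAngle Δ N) (hρ : diskAngle Δ N < Real.pi / 2)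
    (hne : crossing (s.1 i) (s.1 j) ≠ 0) :
    hitCount (band (crossing (s.1 i) (s.1 j)) (2 / Real.pi * diskAngle Δ N)) s.1 ≤
        s.crossingCount Δ i j ∧
      s.crossingCount Δ i j ≤
        hitCount (band (crossing (s.1 i) (s.1 j)) (diskAngle Δ N)) s.1 := by
  classical
  have hband : ∀ ε, band (crossing (s.1 i) (s.1 j)) ε = band (s.meet i j) ε := by
    intro ε
    rcases s.exists_meet_eq hij with h | h
    · rw [h]
    · rw [h, band_neg]
  have hnorm : ‖s.meet i j‖ = 1 := by
    rcases s.exists_meet_eq hij with h | h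
    · rw [h, norm_crossing hne]
    · rw [h, norm_neg, norm_crossing hne]
  rw [hband, hband]
  constructor
  · refine Finset.card_le_card fun k hk => ?_
    exact Finset.mem_filter.2 ⟨Finset.mem_univ _,
      meets_disk_of_abs_inner_le hnorm hρ0 hρ (Finset.mem_filter.1 hk).2⟩
  · refine Finset.card_le_card fun k hk => ?_
    exact Finset.mem_filter.2 ⟨Finset.mem_univ _,
      abs_inner_le_of_meets_disk hnorm (Finset.mem_filter.1 hk).2⟩

end Disk

/-! ### Measurability -/

theorem continuous_cross : Continuous fun p : E3 × E3 => cross p.1 p.2 := by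
  have h : (fun p : E3 × E3 => cross p.1 p.2) = fun p => WithLp.toLp 2
      ![p.1 1 * p.2 2 - p.1 2 * p.2 1, p.1 2 * p.2 0 - p.1 0 * p.2 2,
        p.1 0 * p.2 1 - p.1 1 * p.2 0] := by
    ext p i
    fin_cases i
    · exact cross_apply_zero _ _
    · exact cross_apply_one _ _
    · exact cross_apply_two _ _
  rw [h]
  refine (PiLp.continuous_toLp 2 _).comp (continuous_pi fun i => ?_)
  fin_cases i <;> simp <;> fun_prop

theorem measurable_crossing : Measurable fun p : S2 × S2 => crossing p.1 p.2 := by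
  have h : Measurable fun p : S2 × S2 => cross p.1 p.2 :=
    (continuous_cross.comp (f := fun p : S2 × S2 => ((p.1 : E3), (p.2 : E3)))
      (by fun_prop)).measurable
  exact h.norm.inv.smul h

/-! ### Slicing a product measure over a subset of the coordinates -/

section Slices

variable {ι X : Type*} [MeasurableSpace X]

theorem piEquivPiSubtypeProd_symm_pos (p : ι → Prop) [DecidablePred p] (y : {k // p k} → X)
    (w : {k // ¬p k} → X) {k : ι} (hk : p k) :
    (MeasurableEquiv.piEquivPiSubtypeProd (fun _ => X) p).symm (y, w) k = y ⟨k, hk⟩ := by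
  simp [MeasurableEquiv.piEquivPiSubtypeProd, Equiv.piEquivPiSubtypeProd, hk]

theorem piEquivPiSubtypeProd_symm_neg (p : ι → Prop) [DecidablePred p] (y : {k // p k} → X)
    (w : {k // ¬p k} → X) {k : ι} (hk : ¬p k) :
    (MeasurableEquiv.piEquivPiSubtypeProd (fun _ => X) p).symm (y, w) k = w ⟨k, hk⟩ := by
  simp [MeasurableEquiv.piEquivPiSubtypeProd, Equiv.piEquivPiSubtypeProd, hk]

variable [Fintype ι] {μ : Measure X} [IsProbabilityMeasure μ]

/-- The measure of a set is bounded by the measures of its slices. -/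
theorem pi_le_of_slices (p : ι → Prop) [DecidablePred p] {B : Set (ι → X)} (hB : MeasurableSet B)
    {δ : ENNReal}
    (h : ∀ y : {k // p k} → X, (Measure.pi fun _ : {k // ¬p k} => μ)
      {w | (MeasurableEquiv.piEquivPiSubtypeProd (fun _ => X) p).symm (y, w) ∈ B} ≤ δ) :
    (Measure.pi fun _ : ι => μ) B ≤ δ := by
  set e := MeasurableEquiv.piEquivPiSubtypeProd (fun _ : ι => X) p with he
  have hmp := (measurePreserving_piEquivPiSubtypeProd (fun _ : ι => μ) p).symm e
  rw [← hmp.measure_preimage hB.nullMeasurableSet, Measure.prod_apply (e.symm.measurable hB)]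
  refine (lintegral_mono (g := fun _ => δ) h).trans ?_
  simp

end Slices

/-! ### Probability that the poles give an atypical count -/

section Poles

variable {N : ℕ}

theorem measurable_hitCount_band {i j : Node N} (ε : ℝ) :
    Measurable fun x : Node N → S2 => (hitCount (band (crossing (x i) (x j)) ε) x : ℝ) := by
  classical
  have h : (fun x : Node N → S2 => (hitCount (band (crossing (x i) (x j)) ε) x : ℝ)) =
      fun x => ∑ k, if |inner ℝ (x k : E3) (crossing (x i) (x j))| ≤ ε then (1 : ℝ) else 0 := by
    ext x
    rw [hitCount, Finset.sum_boole]
    rfl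
  rw [h]
  refine Finset.measurable_sum _ fun k _ => Measurable.ite (measurableSet_le ?_ measurable_const)
    measurable_const measurable_const
  have h1 : Measurable fun x : Node N → S2 => crossing (x i) (x j) :=
    measurable_crossing.comp (f := fun x : Node N → S2 => (x i, x j)) (by fun_prop)
  have h2 : Measurable fun x : Node N → S2 => (x k : E3) := by fun_prop
  exact (h2.inner (𝕜 := ℝ) h1).norm

theorem measurableSet_crossing_eq_zero (i j : Node N) :
    MeasurableSet {x : Node N → S2 | crossing (x i) (x j) = 0} := by
  have h1 : Measurable fun x : Node N → S2 => crossing (x i) (x j) :=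
    measurable_crossing.comp (f := fun x : Node N → S2 => (x i, x j)) (by fun_prop)
  exact h1 (measurableSet_singleton 0)

/-- A pole parallel to `x` is orthogonal to any unit vector orthogonal to `x`, hence lies in a band
of width zero. -/
theorem sphereUniform_crossing_eq_zero (x : S2) : sphereUniform {y | crossing x y = 0} = 0 := by
  obtain ⟨C₀, C₁, -, hC₁, hup, -⟩ := exists_sphereUniform_band_bounds
  obtain ⟨b, hb⟩ := exists_orthonormalBasis_zero (S2.norm_eq x)
  have hz : ‖b 1‖ = 1 := b.orthonormal.1 1
  have hxz : inner ℝ (x : E3) (b 1) = (0 : ℝ) := by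
    rw [← hb]
    exact b.orthonormal.2 (by decide)
  have hsub : {y : S2 | crossing x y = 0} ⊆ band (b 1) 0 := by
    intro y hy
    have hc : cross x y = 0 := by
      have hy : ‖cross x y‖⁻¹ • cross x y = 0 := hy
      simpa using hy
    have hpol : inner ℝ (cross x y) (cross x (b 1)) = inner ℝ (x : E3) x * inner ℝ (y : E3) (b 1) -
        inner ℝ (x : E3) (b 1) * inner ℝ (x : E3) y := by
      simp only [inner_E3, cross_apply_zero, cross_apply_one, cross_apply_two]
      ring
    rw [hc, inner_zero_left, S2.inner_self, hxz] at hpol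
    change |inner ℝ (y : E3) (b 1)| ≤ 0
    rw [show inner ℝ (y : E3) (b 1) = (0 : ℝ) by linarith, abs_zero]
  have h0 := hup (b 1) hz 0 le_rfl
  rw [mul_zero] at h0
  have h1 : sphereUniform.real (band (b 1) 0) = 0 := le_antisymm h0 measureReal_nonneg
  exact measure_mono_null hsub ((measureReal_eq_zero_iff).1 h1)

theorem pi_crossing_eq_zero {i j : Node N} (hij : i ≠ j) :
    (Measure.pi fun _ : Node N => sphereUniform) {x | crossing (x i) (x j) = 0} = 0 := by
  classical
  refine le_antisymm (pi_le_of_slices (fun k => k = i) (measurableSet_crossing_eq_zero i j)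
    fun y => ?_) zero_le
  have hset : {w : {k : Node N // ¬k = i} → S2 |
      (MeasurableEquiv.piEquivPiSubtypeProd (fun _ => S2) (fun k => k = i)).symm (y, w) ∈
        {x : Node N → S2 | crossing (x i) (x j) = 0}} =
      Function.eval ⟨j, hij.symm⟩ ⁻¹' {v | crossing (y ⟨i, rfl⟩) v = 0} := by
    ext w
    simp only [Set.mem_ofPred_eq, Set.mem_preimage, Function.eval]
    rw [piEquivPiSubtypeProd_symm_pos (fun k => k = i) y w rfl,
      piEquivPiSubtypeProd_symm_neg (fun k => k = i) y w (Ne.symm hij)]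
  rw [hset]
  have hmp := measurePreserving_eval (fun _ : {k : Node N // ¬k = i} => sphereUniform)
    ⟨j, hij.symm⟩
  exact (hmp.quasiMeasurePreserving.preimage_null (sphereUniform_crossing_eq_zero _)).le

/-- The poles of `i` and `j` determine the center of the band and must be frozen; they change the
count by at most `2`. -/
theorem hitCount_glue_le {i j : Node N} (S : Set S2) (y : {k : Node N // k = i ∨ k = j} → S2)
    (w : {k : Node N // ¬(k = i ∨ k = j)} → S2) :
    hitCount S w ≤ hitCount S ((MeasurableEquiv.piEquivPiSubtypeProd (fun _ => S2)
        (fun k => k = i ∨ k = j)).symm (y, w)) ∧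
      hitCount S ((MeasurableEquiv.piEquivPiSubtypeProd (fun _ => S2)
        (fun k => k = i ∨ k = j)).symm (y, w)) ≤ hitCount S w + 2 := by
  classical
  set x := (MeasurableEquiv.piEquivPiSubtypeProd (fun _ => S2)
    (fun k => k = i ∨ k = j)).symm (y, w) with hx
  have hxw : ∀ k (hk : ¬(k = i ∨ k = j)), x k = w ⟨k, hk⟩ := fun k hk =>
    piEquivPiSubtypeProd_symm_neg _ y w hk
  constructor
  · unfold hitCount
    refine Finset.card_le_card_of_injOn Subtype.val (fun k hk => ?_) Subtype.val_injective.injOn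
    have := (Finset.mem_filter.1 hk).2
    refine Finset.mem_coe.2 (Finset.mem_filter.2 ⟨Finset.mem_univ _, ?_⟩)
    rw [hxw k.1 k.2]
    exact this
  · unfold hitCount
    have hsub : (Finset.univ.filter fun k => x k ∈ S) ⊆
        ((Finset.univ.filter fun k => w k ∈ S).image Subtype.val) ∪ {i, j} := by
      intro k hk
      have hk := (Finset.mem_filter.1 hk).2
      by_cases hp : k = i ∨ k = j
      · exact Finset.mem_union_right _ (by simpa using hp)
      · refine Finset.mem_union_left _ (Finset.mem_image.2 ⟨⟨k, hp⟩, ?_, rfl⟩)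
        rw [hxw k hp] at hk
        exact Finset.mem_filter.2 ⟨Finset.mem_univ _, hk⟩
    refine (Finset.card_le_card hsub).trans ((Finset.card_union_le _ _).trans ?_)
    exact Nat.add_le_add Finset.card_image_le Finset.card_le_two

theorem card_others {i j : Node N} (hij : i ≠ j) :
    Fintype.card {k : Node N // ¬(k = i ∨ k = j)} = 2 * N - 2 := by
  classical
  rw [Fintype.card_subtype_compl, Fintype.card_fin, Fintype.card_subtype]
  have h : (Finset.univ.filter fun k : Node N => k = i ∨ k = j) = {i, j} := by
    ext k
    simp
  rw [h, Finset.card_pair hij]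

/-- The poles for which the number of great circles near the intersection point of two great
circles is not of the right order. -/
def badPoles (Δ a b : ℝ) (i j : Node N) : Set (Node N → S2) :=
  {x | crossing (x i) (x j) ≠ 0} ∩
    ({x | b * √((2 * N : ℕ) : ℝ) ≤
        hitCount (band (crossing (x i) (x j)) (diskAngle Δ N)) x} ∪
      {x | (hitCount (band (crossing (x i) (x j)) (2 / Real.pi * diskAngle Δ N)) x : ℝ) ≤
        a * √((2 * N : ℕ) : ℝ)})

theorem measurableSet_badPoles (Δ a b : ℝ) (i j : Node N) :
    MeasurableSet (badPoles Δ a b i j) := by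
  refine (measurableSet_crossing_eq_zero i j).compl.inter (MeasurableSet.union ?_ ?_)
  · exact measurableSet_le measurable_const (measurable_hitCount_band _)
  · exact measurableSet_le (measurable_hitCount_band _) measurable_const

theorem typical_of_notMem {Δ a b : ℝ} {s : Config N} (hρ0 : 0 ≤ diskAngle Δ N)
    (hρ : diskAngle Δ N < Real.pi / 2)
    (hs : ∀ i j : Node N, i < j → crossing (s.1 i) (s.1 j) ≠ 0 ∧ s.1 ∉ badPoles Δ a b i j) :
    s.Typical Δ a b := by
  have key : ∀ i j : Node N, i < j → a * √((2 * N : ℕ) : ℝ) ≤ (s.crossingCount Δ i j : ℝ) ∧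
      (s.crossingCount Δ i j : ℝ) ≤ b * √((2 * N : ℕ) : ℝ) := by
    intro i j hij
    obtain ⟨hne, hbad⟩ := hs i j hij
    obtain ⟨h1, h2⟩ := s.crossingCount_bounds hij hρ0 hρ hne
    have h1' : (hitCount (band (crossing (s.1 i) (s.1 j)) (2 / Real.pi * diskAngle Δ N)) s.1 : ℝ) ≤
      s.crossingCount Δ i j := by exact_mod_cast h1
    have h2' : (s.crossingCount Δ i j : ℝ) ≤
      hitCount (band (crossing (s.1 i) (s.1 j)) (diskAngle Δ N)) s.1 := by exact_mod_cast h2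
    constructor
    · by_contra hlt
      exact hbad ⟨hne, Or.inr (h1'.trans (not_le.1 hlt).le)⟩
    · by_contra hlt
      exact hbad ⟨hne, Or.inl ((not_le.1 hlt).le.trans h2')⟩
  intro i j hij
  rcases lt_or_gt_of_ne hij with h | h
  · exact key i j h
  · have hc : s.crossingCount Δ i j = s.crossingCount Δ j i := by
      unfold Config.crossingCount
      rw [s.meet_comm i j]
    rw [hc]
    exact key j i h

/-- With the poles of `i` and `j` fixed, `z` is deterministic and the other `2N - 2` poles are
i.i.d., so the Chernoff bounds apply uniformly in `z`. The `- 2` in `hup` pays for the frozen poles.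
-/
theorem pi_badPoles_le {Δ a b A B : ℝ} {i j : Node N} (hij : i ≠ j)
    (hup : ∀ z : E3, ‖z‖ = 1 → 2 * (((2 * N - 2 : ℕ) : ℝ) *
      sphereUniform.real (band z (diskAngle Δ N))) - (b * √((2 * N : ℕ) : ℝ) - 2) ≤ B)
    (hlo : ∀ z : E3, ‖z‖ = 1 → a * √((2 * N : ℕ) : ℝ) - ((2 * N - 2 : ℕ) : ℝ) *
      sphereUniform.real (band z (2 / Real.pi * diskAngle Δ N)) / 2 ≤ A) :
    (Measure.pi fun _ : Node N => sphereUniform) (badPoles Δ a b i j) ≤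
      ENNReal.ofReal (Real.exp B + Real.exp A) := by
  classical
  refine pi_le_of_slices (fun k => k = i ∨ k = j) (measurableSet_badPoles Δ a b i j) fun y => ?_
  set z := crossing (y ⟨i, Or.inl rfl⟩) (y ⟨j, Or.inr rfl⟩) with hz
  by_cases hz0 : z = 0
  · have : {w : {k : Node N // ¬(k = i ∨ k = j)} → S2 |
        (MeasurableEquiv.piEquivPiSubtypeProd (fun _ => S2) (fun k => k = i ∨ k = j)).symm (y, w) ∈
          badPoles Δ a b i j} = ∅ := by
      refine Set.eq_empty_of_forall_notMem fun w hw => hw.1 ?_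
      rw [piEquivPiSubtypeProd_symm_pos _ y w (Or.inl rfl),
        piEquivPiSubtypeProd_symm_pos _ y w (Or.inr rfl), ← hz, hz0]
    rw [this, measure_empty]
    exact zero_le
  have hz1 : ‖z‖ = 1 := norm_crossing hz0
  have hsub : {w : {k : Node N // ¬(k = i ∨ k = j)} → S2 |
      (MeasurableEquiv.piEquivPiSubtypeProd (fun _ => S2) (fun k => k = i ∨ k = j)).symm (y, w) ∈
        badPoles Δ a b i j} ⊆
      {w | b * √((2 * N : ℕ) : ℝ) - 2 ≤ hitCount (band z (diskAngle Δ N)) w} ∪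
        {w | (hitCount (band z (2 / Real.pi * diskAngle Δ N)) w : ℝ) ≤
          a * √((2 * N : ℕ) : ℝ)} := by
    rintro w ⟨-, hw⟩
    simp only [Set.mem_union, Set.mem_ofPred_eq] at hw ⊢
    rw [piEquivPiSubtypeProd_symm_pos _ y w (Or.inl rfl),
      piEquivPiSubtypeProd_symm_pos _ y w (Or.inr rfl), ← hz] at hw
    rcases hw with h | h
    · left
      have h2 := (hitCount_glue_le (band z (diskAngle Δ N)) y w).2
      have h3 := Nat.cast_le (α := ℝ) |>.2 h2
      push_cast at h3 h ⊢
      linarith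
    · right
      have h2 := (hitCount_glue_le (band z (2 / Real.pi * diskAngle Δ N)) y w).1
      have h3 := Nat.cast_le (α := ℝ) |>.2 h2
      exact h3.trans h
  refine (measure_mono hsub).trans ((measure_union_le _ _).trans ?_)
  rw [ENNReal.ofReal_add (Real.exp_pos _).le (Real.exp_pos _).le]
  have h1 := measure_le_hitCount_le (ι := {k : Node N // ¬(k = i ∨ k = j)})
    (μ := sphereUniform) (measurableSet_band z (diskAngle Δ N)) (b * √((2 * N : ℕ) : ℝ) - 2)
  have h2 := measure_hitCount_le_le (ι := {k : Node N // ¬(k = i ∨ k = j)})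
    (μ := sphereUniform) (measurableSet_band z (2 / Real.pi * diskAngle Δ N))
    (a * √((2 * N : ℕ) : ℝ))
  rw [card_others hij] at h1 h2
  refine add_le_add ?_ ?_
  · rw [← ofReal_measureReal]
    exact ENNReal.ofReal_le_ofReal (h1.trans (Real.exp_le_exp.2 (hup z hz1)))
  · rw [← ofReal_measureReal]
    exact ENNReal.ofReal_le_ofReal (h2.trans (Real.exp_le_exp.2 (hlo z hz1)))

end Poles

end

/-! ### Typical configurations have probability tending to one -/

/-- A bound for the probability that the count at one intersection point is atypical. -/
def tailBound (κ : ℝ) (N : ℕ) : ℝ :=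
  Real.exp (2 - √((2 * N : ℕ) : ℝ)) + Real.exp (-(κ * √((2 * N : ℕ) : ℝ)))

theorem exists_pi_badPoles_le {Δ : ℝ} (hΔ : 0 < Δ) :
    ∃ a₀ b₀ κ : ℝ, 0 < a₀ ∧ a₀ < b₀ ∧ 0 < κ ∧ ∀ a b : ℝ, a ≤ a₀ → b₀ ≤ b →
      ∀ N : ℕ, 2 ≤ N → 4 * (2 + Δ) < latticeSize N → ∀ i j : Node N, i ≠ j →
        (Measure.pi fun _ : Node N => sphereUniform) (badPoles Δ a b i j) ≤
          ENNReal.ofReal (tailBound κ N) := by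
  obtain ⟨C₀, C₁, hC₀, hC₁, hup, hlo⟩ := exists_sphereUniform_band_bounds
  set κ₁ := 2 * Real.pi * (2 + Δ) * C₁ with hκ₁
  set κ₀ := 2 * C₀ * (2 + Δ) with hκ₀
  have hpi := Real.pi_pos
  have hκ₀pos : 0 < κ₀ := by positivity
  -- The mean counts are at most `κ₁ √n` for the wide band and at least `κ₀ √n` for the narrow one.
  -- With these thresholds the Chernoff exponents are at most `2 - √n` and `-κ₀ √n / 4`. The second
  -- entry of the maximum only secures `a₀ < b₀`.
  refine ⟨κ₀ / 4, max (2 * κ₁ + 1) (κ₀ / 4 + 1), κ₀ / 4, by positivity,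
    lt_max_of_lt_right (by linarith), by positivity, ?_⟩
  intro a b ha hb N hN hm i j hij
  set r := √((2 * N : ℕ) : ℝ) with hr
  have hmr : (latticeSize N : ℝ) ≤ r := latticeSize_le_sqrt
  have hr0 : 0 < r := by linarith
  have hrsq : r * r = 2 * N := by
    rw [hr, Real.mul_self_sqrt (by positivity)]
    push_cast
    ring
  have hcard : ((2 * N - 2 : ℕ) : ℝ) = 2 * N - 2 := by
    rw [Nat.cast_sub (by omega)]
    push_cast
    ring
  have hN2 : (2 : ℝ) ≤ N := by exact_mod_cast hN
  have hρ : diskAngle Δ N = 2 * Real.pi * (2 + Δ) / r := rfl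
  have hρ0 : 0 ≤ diskAngle Δ N := by rw [hρ]; positivity
  have hw : 2 / Real.pi * diskAngle Δ N = 4 * (2 + Δ) / r := by
    rw [hρ]
    field_simp
    ring
  refine pi_badPoles_le hij (fun z hz => ?_) fun z hz => ?_
  · have h1 := hup z hz _ hρ0
    have h2 : ((2 * N - 2 : ℕ) : ℝ) * sphereUniform.real (band z (diskAngle Δ N)) ≤
        (r * r) * (C₁ * diskAngle Δ N) := by
      refine mul_le_mul ?_ h1 measureReal_nonneg (by positivity)
      rw [hcard, hrsq]
      linarith
    have h3 : (r * r) * (C₁ * diskAngle Δ N) = κ₁ * r := by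
      rw [hρ, hκ₁]
      field_simp
    have h4 : (2 * κ₁ + 1) * r ≤ b * r :=
      mul_le_mul_of_nonneg_right ((le_max_left _ _).trans hb) hr0.le
    linarith
  · have h1 := hlo z hz (4 * (2 + Δ) / r) (by positivity)
      ((div_le_one hr0).2 (by linarith))
    rw [hw]
    have h2 : (r * r) / 2 * (C₀ * (4 * (2 + Δ) / r)) ≤
        ((2 * N - 2 : ℕ) : ℝ) * sphereUniform.real (band z (4 * (2 + Δ) / r)) := by
      refine mul_le_mul ?_ h1 (by positivity) (by positivity)
      rw [hcard, hrsq]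
      linarith
    have h3 : (r * r) / 2 * (C₀ * (4 * (2 + Δ) / r)) = κ₀ * r := by
      rw [hκ₀]
      field_simp
      ring
    have h4 : a * r ≤ κ₀ / 4 * r := mul_le_mul_of_nonneg_right ha hr0.le
    linarith

theorem tendsto_sq_mul_tailBound {κ : ℝ} (hκ : 0 < κ) :
    Tendsto (fun N : ℕ => ((2 * N : ℕ) : ℝ) ^ 2 * tailBound κ N) atTop (𝓝 0) := by
  have hsqrt : Tendsto (fun N : ℕ => √((2 * N : ℕ) : ℝ)) atTop atTop := by
    refine Real.tendsto_sqrt_atTop.comp (tendsto_natCast_atTop_atTop.comp ?_)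
    exact tendsto_id.const_mul_atTop' two_pos
  have hexp : ∀ l : ℝ, 0 < l →
      Tendsto (fun N : ℕ => √((2 * N : ℕ) : ℝ) ^ 4 * Real.exp (-(l * √((2 * N : ℕ) : ℝ)))) atTop
        (𝓝 0) := by
    intro l hl
    have h := ((Real.tendsto_pow_mul_exp_neg_atTop_nhds_zero 4).comp
      (hsqrt.const_mul_atTop hl)).const_mul ((l ^ 4)⁻¹)
    rw [mul_zero] at h
    refine h.congr fun N => ?_
    simp only [Function.comp_apply, mul_pow]
    field_simp
  have h := ((hexp 1 one_pos).const_mul (Real.exp 2)).add (hexp κ hκ)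
  rw [mul_zero, add_zero] at h
  refine h.congr fun N => ?_
  have h4 : √((2 * N : ℕ) : ℝ) ^ 4 = ((2 * N : ℕ) : ℝ) ^ 2 := by
    rw [show 4 = 2 * 2 from rfl, pow_mul, Real.sq_sqrt (by positivity)]
  rw [h4, tailBound, sub_eq_add_neg, Real.exp_add, one_mul]
  ring

/-! ### From the poles to the full law, and the union bound -/

theorem isProbabilityMeasure_uniformOn_univ {X : Type*} [Fintype X] [Nonempty X]
    [MeasurableSpace X] [MeasurableSingletonClass X] :
    IsProbabilityMeasure (uniformOn (Set.univ : Set X)) :=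
  isProbabilityMeasure_uniformOn Set.finite_univ Set.univ_nonempty

instance isProbabilityMeasure_configMeasure (N : ℕ) :
    IsProbabilityMeasure (configMeasure N) := by
  have : Nonempty (Pairing N) :=
    ⟨Fintype.equivOfCardEq (by simp [mul_comm])⟩
  have h1 : IsProbabilityMeasure (uniformOn (Set.univ : Set (Pairing N))) :=
    isProbabilityMeasure_uniformOn_univ
  have h2 : IsProbabilityMeasure (uniformOn (Set.univ : Set Bool)) :=
    isProbabilityMeasure_uniformOn_univ
  unfold configMeasure
  infer_instance

theorem isProbabilityMeasure_uniformOn_lattice {N : ℕ} [NeZero (latticeSize N)] :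
    IsProbabilityMeasure (uniformOn (Set.univ : Set (ZMod (latticeSize N)))) :=
  isProbabilityMeasure_uniformOn_univ

instance isProbabilityMeasure_law {N : ℕ} [NeZero (latticeSize N)] (p α : unitInterval) :
    IsProbabilityMeasure (law p α N) := by
  have := isProbabilityMeasure_uniformOn_lattice (N := N)
  unfold law
  infer_instance

theorem law_preimage_poles {N : ℕ} [NeZero (latticeSize N)] (p α : unitInterval)
    (B : Set (Node N → S2)) : law p α N {ω | ω.1.1 ∈ B} ≤
      (Measure.pi fun _ : Node N => sphereUniform) B := by
  have := isProbabilityMeasure_uniformOn_lattice (N := N)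
  have hnonempty : Nonempty (Pairing N) := ⟨Fintype.equivOfCardEq (by simp [mul_comm])⟩
  have h1 : IsProbabilityMeasure (uniformOn (Set.univ : Set (Pairing N))) :=
    isProbabilityMeasure_uniformOn_univ
  have h2 : IsProbabilityMeasure (uniformOn (Set.univ : Set Bool)) :=
    isProbabilityMeasure_uniformOn_univ
  have hset : {ω : Sample N | ω.1.1 ∈ B} = (B ×ˢ Set.univ) ×ˢ Set.univ := by
    ext ω
    simp
  rw [hset, law, Measure.prod_prod, configMeasure, Measure.prod_prod, measure_univ, measure_univ,
    mul_one, mul_one]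

theorem law_not_typical_le {Δ a b κ : ℝ} (hΔ : 0 < Δ) {N : ℕ} (hN : 0 < N)
    [NeZero (latticeSize N)] (hm : 4 * (2 + Δ) < latticeSize N) (p α : unitInterval)
    (h : ∀ i j : Node N, i ≠ j → (Measure.pi fun _ : Node N => sphereUniform)
      (badPoles Δ a b i j) ≤ ENNReal.ofReal (tailBound κ N)) :
    law p α N {ω | ¬ω.1.Typical Δ a b} ≤
      ENNReal.ofReal (((2 * N : ℕ) : ℝ) ^ 2 * tailBound κ N) := by
  have hm0 : (0 : ℝ) < latticeSize N := by exact_mod_cast latticeSize_pos hN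
  have hρ0 : 0 ≤ diskAngle Δ N := by
    have := Real.pi_pos
    unfold diskAngle
    positivity
  have hρ : diskAngle Δ N < Real.pi / 2 := by
    refine (diskAngle_le hΔ hN).trans_lt ?_
    rw [div_lt_div_iff₀ hm0 two_pos]
    nlinarith [Real.pi_pos]
  set B : Node N → Node N → Set (Node N → S2) := fun i j =>
    if i < j then {x | crossing (x i) (x j) = 0} ∪ badPoles Δ a b i j else ∅ with hB
  have htail : 0 ≤ tailBound κ N := by unfold tailBound; positivity
  have hBle : ∀ i j, (Measure.pi fun _ : Node N => sphereUniform) (B i j) ≤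
      ENNReal.ofReal (tailBound κ N) := by
    intro i j
    simp only [hB]
    split_ifs with hij
    · refine (measure_union_le _ _).trans ?_
      rw [pi_crossing_eq_zero hij.ne, zero_add]
      exact h i j hij.ne
    · rw [measure_empty]
      exact zero_le
  have hsub : {ω : Sample N | ¬ω.1.Typical Δ a b} ⊆ {ω | ω.1.1 ∈ ⋃ i, ⋃ j, B i j} := by
    intro ω hω
    by_contra hnot
    refine hω (typical_of_notMem hρ0 hρ fun i j hij => ?_)
    have hBij : ω.1.1 ∉ B i j := fun hmem =>
      hnot (Set.mem_iUnion.2 ⟨i, Set.mem_iUnion.2 ⟨j, hmem⟩⟩)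
    simp only [hB, if_pos hij, Set.mem_union, not_or] at hBij
    exact hBij
  refine (measure_mono hsub).trans ((law_preimage_poles p α _).trans ?_)
  refine (measure_iUnion_fintype_le _ _).trans ?_
  calc ∑ i, (Measure.pi fun _ : Node N => sphereUniform) (⋃ j, B i j)
      ≤ ∑ i : Node N, ∑ j : Node N, ENNReal.ofReal (tailBound κ N) :=
        Finset.sum_le_sum fun i _ => (measure_iUnion_fintype_le _ _).trans
          (Finset.sum_le_sum fun j _ => hBle i j)
    _ = ENNReal.ofReal (((2 * N : ℕ) : ℝ) ^ 2 * tailBound κ N) := by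
        rw [ENNReal.ofReal_mul (by positivity), ENNReal.ofReal_pow (by positivity),
          ENNReal.ofReal_natCast]
        simp only [Finset.sum_const, Finset.card_univ, Fintype.card_fin, nsmul_eq_mul]
        ring

/-! ### The throughput of the scheme -/

theorem tendsto_latticeSize : Tendsto latticeSize atTop atTop := by
  refine tendsto_atTop.2 fun k => ?_
  filter_upwards [eventually_ge_atTop (k * k)] with N hN
  exact Nat.le_sqrt.2 (by omega)

theorem hasThroughput_bitsPi {Δ a b W κ : ℝ} (hΔ : 0 < Δ) (ha : 0 < a) (hb : 0 ≤ b) (hW : 0 < W)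
    (hκ : 0 < κ) {p α : unitInterval} (hp : 0 < p) (hp1 : p < 1) (hα : 0 < α) (hα1 : α < 1)
    (h : ∀ N : ℕ, 2 ≤ N → 4 * (2 + Δ) < latticeSize N → ∀ i j : Node N, i ≠ j →
      (Measure.pi fun _ : Node N => sphereUniform) (badPoles Δ a b i j) ≤
        ENNReal.ofReal (tailBound κ N)) (P : ∀ N, Placement N) :
    HasThroughput (law p α) (fun N => bitsPi Δ W a b (P N))
      fun _ => W * rateConst Δ b p α / 8 := by
  have hlat : Tendsto (fun N => (latticeSize N : ℝ)) atTop atTop :=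
    tendsto_natCast_atTop_atTop.comp tendsto_latticeSize
  have hδ : Tendsto (fun N : ℕ =>
      1 - ENNReal.ofReal (((2 * N : ℕ) : ℝ) ^ 2 * tailBound κ N)) atTop (𝓝 1) := by
    have h1 := ENNReal.tendsto_ofReal (tendsto_sq_mul_tailBound hκ)
    have h2 := ENNReal.Tendsto.sub (tendsto_const_nhds (x := (1 : ENNReal))) h1
      (Or.inl ENNReal.one_ne_top)
    simpa using h2
  refine tendsto_of_tendsto_of_tendsto_of_le_of_le' hδ tendsto_const_nhds ?_ ?_
  · filter_upwards [eventually_ge_atTop 2, hlat.eventually_gt_atTop (4 * (2 + Δ)),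
      hlat.eventually_ge_atTop (2 * (nearBound Δ : ℝ))] with N hN hm hQ
    have : NeZero (latticeSize N) := ⟨(latticeSize_pos (by omega)).ne'⟩
    set G : Set (Sample N) := {ω | ∀ c : Fin N, W * rateConst Δ b p α / 8 ≤
      liminf (fun t : ℕ => bitsPi Δ W a b (P N) ω c t / (t : ℝ)) atTop} with hG
    have hreg : law p α N {ω | ¬RegularFrequencies p α ω} = 0 :=
      ae_iff.1 (ae_regularFrequencies hp hp1 hα hα1 (by omega))
    have hsub : Gᶜ ⊆ {ω | ¬ω.1.Typical Δ a b} ∪ {ω | ¬RegularFrequencies p α ω} := by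
      intro ω hω
      by_contra hnot
      simp only [Set.mem_union, Set.mem_ofPred_eq, not_or, not_not] at hnot
      exact hω fun c => le_liminf_bitsPi_of_typical hΔ ha hb hW hp hp1 hα hα1 hN hm hQ
        hnot.1 hnot.2 c
    have hcompl : law p α N Gᶜ ≤
        ENNReal.ofReal (((2 * N : ℕ) : ℝ) ^ 2 * tailBound κ N) := by
      refine (measure_mono hsub).trans ((measure_union_le _ _).trans ?_)
      rw [hreg, add_zero]
      exact law_not_typical_le hΔ (by omega) hm p α (h N hN hm)
    -- Subadditivity of the outer measure is enough, so measurability of `G` need not be known.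
    have hone : 1 ≤ law p α N G + law p α N Gᶜ := by
      rw [← measure_univ (μ := law p α N), ← Set.union_compl_self G]
      exact measure_union_le _ _
    exact tsub_le_iff_right.2 (hone.trans (by gcongr))
  · filter_upwards [eventually_ge_atTop 1] with N hN
    have : NeZero (latticeSize N) := ⟨(latticeSize_pos (by omega)).ne'⟩
    exact prob_le_one

end

end MobileNet

theorem mainTheorem2 (Δ : ℝ) (hΔ : 0 < Δ) :
    ∃ a₀ b₀ : ℝ, 0 < a₀ ∧ a₀ < b₀ ∧ ∀ a b : ℝ, 0 < a → a ≤ a₀ → b₀ ≤ b →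
      ∀ (W : ℝ) (p α : unitInterval), 0 < W → 0 < p → p < 1 → 0 < α → α < 1 →
        ∃ c C : ℝ, 0 < c ∧ ∀ P : ∀ N, MobileNet.Placement N,
          MobileNet.HasThroughput (MobileNet.law p α)
            (fun N => MobileNet.bitsPi Δ W a b (P N)) (fun _ => c) ∧
          ∀ T : ℕ → ℝ,
            MobileNet.HasThroughput (MobileNet.law p α)
              (fun N => MobileNet.bitsPi Δ W a b (P N)) T →
            ∀ᶠ N in Filter.atTop, T N ≤ C := by
  obtain ⟨a₀, b₀, κ, ha₀, hab₀, hκ, h⟩ := MobileNet.exists_pi_badPoles_le hΔ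
  refine ⟨a₀, b₀, ha₀, hab₀, fun a b ha haa hbb W p α hW hp hp1 hα hα1 => ?_⟩
  have hpos := MobileNet.rateConst_pos Δ b hp hp1 hα
  refine ⟨W * MobileNet.rateConst Δ b p α / 8, W, by positivity, fun P => ⟨?_, fun T hT => ?_⟩⟩
  · exact MobileNet.hasThroughput_bitsPi hΔ ha (by linarith) hW hκ hp hp1 hα hα1
      (h a b haa hbb) P
  · exact MobileNet.eventually_le_of_hasThroughput hW.le Δ a b p α P hT
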